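/- Let $A,B,C$ be independent random points, each uniformly distributed on the unit sphere $S^2\subset\mathbb R^3$, defined on an arbitrary probability space. In the spherical triangle $ABC$ let $a\in[0,\pi]$ be the length of the side (great circle arc) joining $B$ and $C$, let $\alpha\in[0,\pi]$ be the angle at $A$, opposite to $a$, and let $\beta\in[0,\pi]$ be the angle at $B$; here the angle at a vertex is the dihedral angle between the two half-planes that are bounded by the line through the origin and that vertex and contain the two sides meeting there. Then the conditional expectation $E(\alpha a\mid\beta=\pi/2)$ is well defined, in the sense that $\alpha a$ is integrable, that $x\mapsto E(\alpha a\mid\beta=x)$ has a Borel version which is continuous at $x=\pi/2$, and that all such versions have the same value at $\pi/2$; and $$E\!\left(\alpha a\;\middle|\;\beta=\tfrac{\pi}{2}\right)=\frac{\pi}{4}\int_0^{\pi}\theta\tan(\theta)\,\bigl[\cos(\theta)+\sin(\theta)-1\bigr]\,d\theta=\frac{\pi}{4}\bigl[2+(1+\ln 2)\,\pi-4G\bigr]=2.8708787\ldots,$$ where the integrand is integrable on $[0,\pi]$, $G=\sum_{k=0}^{\infty}\frac{(-1)^k}{(2k+1)^2}$ is Catalan's constant, and the decimal expansion means that the value lies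 in $[2.8708787,\,2.8708788)$. -/

import Mathlib

open MeasureTheory ProbabilityTheory

noncomputable section

/-- The unit sphere in Euclidean three-space. -/
abbrev UnitSphere : Type := Metric.sphere (0 : EuclideanSpace ℝ (Fin 3)) 1

/-- The uniform probability measure on the unit sphere: surface measure, normalized to mass one. -/
def uniformSphere : Measure UnitSphere :=
  ((volume : Measure (EuclideanSpace ℝ (Fin 3))).toSphere Set.univ)⁻¹ •
    (volume : Measure (EuclideanSpace ℝ (Fin 3))).toSphere

/-- The length in `[0, π]` of the side joining `Q` and `R`: the (shorter) great circle arc between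
these points of the unit sphere, that is, the angle which it subtends at the origin. -/
def sphericalSide (Q R : UnitSphere) : ℝ :=
  InnerProductGeometry.angle (Q : EuclideanSpace ℝ (Fin 3)) (R : EuclideanSpace ℝ (Fin 3))

/-- The component of `Q` orthogonal to `P`; it points along the initial direction at `P` of the
arc from `P` to `Q`. -/
def arcDirection (P Q : UnitSphere) : EuclideanSpace ℝ (Fin 3) :=
  (Q : EuclideanSpace ℝ (Fin 3)) -
    (inner ℝ (P : EuclideanSpace ℝ (Fin 3)) (Q : EuclideanSpace ℝ (Fin 3))) •
      (P : EuclideanSpace ℝ (Fin 3))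

/-- The angle in `[0, π]` at the vertex `P` of the spherical triangle `P Q R`: the dihedral angle,
along the line through the origin and `P`, between the half-planes containing the arcs `P Q` and
`P R`. -/
def sphericalAngle (P Q R : UnitSphere) : ℝ :=
  InnerProductGeometry.angle (arcDirection P Q) (arcDirection P R)

/-- `m` is a version of `x ↦ E(Y | X = x)`: it is Borel measurable, and `m (X)` is almost surely
the conditional expectation of `Y` given the sigma-algebra generated by `X`. -/
def IsCondExpVersion {Ω : Type*} [MeasurableSpace Ω] (P : Measure Ω) (Y X : Ω → ℝ)
    (m : ℝ → ℝ) : Prop :=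
  Measurable m ∧
    (fun ω => m (X ω)) =ᵐ[P] P[Y | MeasurableSpace.comap X (inferInstance : MeasurableSpace ℝ)]

/-- `E(Y | X = x) = e` at an individual value `x` (possibly of probability zero): `Y` is
integrable, `y ↦ E(Y | X = y)` has a version that is continuous at `x`, and every such version
takes the value `e` at `x`. -/
def HasCondExpAt {Ω : Type*} [MeasurableSpace Ω] (P : Measure Ω) (Y X : Ω → ℝ) (x e : ℝ) : Prop :=
  Integrable Y P ∧
    (∃ m : ℝ → ℝ, IsCondExpVersion P Y X m ∧ ContinuousAt m x) ∧
    ∀ m : ℝ → ℝ, IsCondExpVersion P Y X m → ContinuousAt m x → m x = e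

/-- Catalan's constant `G = 1 - 1/9 + 1/25 - ⋯`. -/
def catalanConstant : ℝ := ∑' k : ℕ, (-1 : ℝ) ^ k / (2 * (k : ℝ) + 1) ^ 2

end

/-! Uniform measure is invariant under linear isometries, which also preserve sides and angles, so
`B` may be placed at the north pole. In spherical coordinates the polar angles of `C` and `A` are
then the sides `a` and `c`, with density proportional to sine, and `β` is the difference of the
azimuths folded into `[0, π]`. Hence `β` is uniform on `(0, π)` and independent of `(a, c)`, while
`α` is a function of `(a, c, cos β)` by the spherical law of cosines
(`lintegral_uniformSphere_prod`, `map_sphericalAngle_sphericalAngle_mul_side`).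

Since the joint law of `(β, αa)` is the image of a product measure, integrating out `(a, c)` at
fixed `β = x` gives a version of the conditional expectation (`isCondExpVersion_of_map_prodMk_eq`).
It is continuous at `π/2` by dominated convergence. Two versions agree almost everywhere on `(0,
π)`, so they agree at a common point of continuity.

At `β = π/2`, Napier's rule `cot α = cot a sin c` makes `α = π/2 - arctan (k sin c)` with `k = cot
a`. The integral over `c` is elementary (`mul_integral_sin_mul_arctan`), and the remaining integral
over `a` is the stated one. In it the pole of the tangent cancels, leaving elementary terms and `∫ θ
cos θ / (1 + sin θ)`. Folding at `π/2` and passing to the half angle turns the latter into `∫ u tan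
u` over `[0, π/4]`, which combines Euler's log-sine integral with `∫ arctan x / x = G`. The decimals
come from an accelerated alternating series for `G`. -/

/-! ### Spherical coordinates and surface measure -/

/-- Lebesgue integration over Euclidean three-space in Cartesian coordinates. -/
theorem lintegral_euclideanSpace_three
    {f : EuclideanSpace ℝ (Fin 3) → ENNReal} (hf : Measurable f) :
    ∫⁻ x, f x = ∫⁻ z : ℝ, ∫⁻ p : ℝ × ℝ, f !₂[p.1, p.2, z] := by
  have h1 : MeasurePreserving (fun q : ℝ × (ℝ × ℝ) => (!₂[q.2.1, q.2.2, q.1] :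
      EuclideanSpace ℝ (Fin 3))) volume volume := by
    have hA : MeasurePreserving (Prod.map id (MeasurableEquiv.finTwoArrow (α := ℝ)).symm)
        (volume : Measure (ℝ × (ℝ × ℝ))) (volume : Measure (ℝ × (Fin 2 → ℝ))) :=
      (MeasurePreserving.id volume).prod ((volume_preserving_finTwoArrow ℝ).symm _)
    have hB := (volume_preserving_piFinSuccAbove (fun _ : Fin 3 => ℝ) 2).symm
    have hC := PiLp.volume_preserving_toLp (Fin 3)
    have := hC.comp (hB.comp hA)
    have he : (fun q : ℝ × (ℝ × ℝ) => (!₂[q.2.1, q.2.2, q.1] : EuclideanSpace ℝ (Fin 3))) =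
        WithLp.toLp 2 ∘ (MeasurableEquiv.piFinSuccAbove (fun _ : Fin 3 => ℝ) 2).symm ∘
          Prod.map id (MeasurableEquiv.finTwoArrow (α := ℝ)).symm := by
      funext q
      ext i
      fin_cases i <;> rfl
    rw [he]
    exact this
  rw [← h1.lintegral_comp hf, Measure.volume_eq_prod, lintegral_prod]
  exact (hf.comp h1.measurable).aemeasurable

/-- The point of the unit sphere with polar angle `p.1` and azimuth `p.2`. -/
noncomputable def sphericalPoint (p : ℝ × ℝ) : UnitSphere :=
  ⟨!₂[Real.sin p.1 * Real.cos p.2, Real.sin p.1 * Real.sin p.2, Real.cos p.1], by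
    have : (Real.sin p.1 * Real.cos p.2) ^ 2 + (Real.sin p.1 * Real.sin p.2) ^ 2 +
        Real.cos p.1 ^ 2 = 1 := by
      nlinarith [Real.sin_sq_add_cos_sq p.1, Real.sin_sq_add_cos_sq p.2]
    simp [EuclideanSpace.norm_eq, Fin.sum_univ_three, this]⟩

theorem continuous_sphericalPoint : Continuous sphericalPoint := by
  refine Continuous.subtype_mk ?_ _
  refine (PiLp.continuous_toLp 2 _).comp (continuous_pi fun i => ?_)
  fin_cases i <;> simp <;> fun_prop

/-- Integration over Euclidean three-space in spherical coordinates. -/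
theorem lintegral_spherical {f : EuclideanSpace ℝ (Fin 3) → ENNReal} (hf : Measurable f) :
    ∫⁻ x, f x = ∫⁻ p in Set.Ioo 0 Real.pi ×ˢ Set.Ioo (-Real.pi) Real.pi,
      ENNReal.ofReal (Real.sin p.1) * ∫⁻ r in Set.Ioi (0 : ℝ), ENNReal.ofReal (r ^ 2) *
        f (r • (sphericalPoint p : EuclideanSpace ℝ (Fin 3))) := by
  have hpt : ∀ g : ℝ × ℝ → ℝ × ℝ × ℝ, Measurable g → Measurable (fun p =>
      (!₂[(g p).1, (g p).2.1, (g p).2.2] : EuclideanSpace ℝ (Fin 3))) := by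
    intro g hg
    refine (PiLp.continuous_toLp 2 _).measurable.comp (measurable_pi_lambda _ fun i => ?_)
    fin_cases i <;> simp <;> fun_prop
  have hpt3 : ∀ g : (ℝ × ℝ) × ℝ → ℝ × ℝ × ℝ, Measurable g → Measurable (fun p =>
      (!₂[(g p).1, (g p).2.1, (g p).2.2] : EuclideanSpace ℝ (Fin 3))) := by
    intro g hg
    refine (PiLp.continuous_toLp 2 _).measurable.comp (measurable_pi_lambda _ fun i => ?_)
    fin_cases i <;> simp <;> fun_prop
  rw [lintegral_euclideanSpace_three hf]
  -- Polar coordinates in a horizontal plane; here `r` is the distance from the vertical axis.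
  have step1 : ∀ z : ℝ, ∫⁻ p : ℝ × ℝ, f !₂[p.1, p.2, z] =
      ∫⁻ φ in Set.Ioo (-Real.pi) Real.pi, ∫⁻ r in Set.Ioi (0 : ℝ),
        ENNReal.ofReal r * f !₂[r * Real.cos φ, r * Real.sin φ, z] := by
    intro z
    rw [← lintegral_comp_polarCoord_symm, polarCoord_target, Measure.volume_eq_prod,
      ← Measure.prod_restrict, lintegral_prod_symm]
    · rfl
    · refine Measurable.aemeasurable ?_
      simp only [polarCoord_symm_apply, smul_eq_mul]
      refine Measurable.mul (by fun_prop) (hf.comp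
        (hpt (fun p => (p.1 * Real.cos p.2, p.1 * Real.sin p.2, z)) (by fun_prop)))
  -- Polar coordinates again, now in the half-plane of points `(z, r)` with `r > 0`. The indicator
  -- of `r > 0` cuts the polar angle down from `(-π, π)` to `(0, π)`, and the two Jacobians multiply
  -- to `r² sin θ`.
  have step2 : ∀ φ : ℝ, ∫⁻ z : ℝ, ∫⁻ r in Set.Ioi (0 : ℝ),
        ENNReal.ofReal r * f !₂[r * Real.cos φ, r * Real.sin φ, z] =
      ∫⁻ θ in Set.Ioo 0 Real.pi, ENNReal.ofReal (Real.sin θ) *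
        ∫⁻ r in Set.Ioi (0 : ℝ), ENNReal.ofReal (r ^ 2) *
        f (r • (sphericalPoint (θ, φ) : EuclideanSpace ℝ (Fin 3))) := by
    intro φ
    have hm : Measurable (fun q : ℝ × ℝ => (Set.Ioi (0 : ℝ)).indicator (fun r =>
        ENNReal.ofReal r * f !₂[r * Real.cos φ, r * Real.sin φ, q.1]) q.2) := by
      have : Measurable (fun q : ℝ × ℝ => ENNReal.ofReal q.2 *
          f !₂[q.2 * Real.cos φ, q.2 * Real.sin φ, q.1]) :=
        Measurable.mul (by fun_prop) (hf.comp
          (hpt (fun q => (q.2 * Real.cos φ, q.2 * Real.sin φ, q.1)) (by fun_prop)))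
      exact this.indicator (measurable_snd measurableSet_Ioi)
    calc ∫⁻ z : ℝ, ∫⁻ r in Set.Ioi (0 : ℝ),
        ENNReal.ofReal r * f !₂[r * Real.cos φ, r * Real.sin φ, z]
        = ∫⁻ q : ℝ × ℝ, (Set.Ioi (0 : ℝ)).indicator (fun r =>
            ENNReal.ofReal r * f !₂[r * Real.cos φ, r * Real.sin φ, q.1]) q.2 := by
          rw [Measure.volume_eq_prod, lintegral_prod _ hm.aemeasurable]
          refine lintegral_congr fun z => ?_
          exact (lintegral_indicator measurableSet_Ioi _).symm
      _ = ∫⁻ θ in Set.Ioo (-Real.pi) Real.pi, ∫⁻ r in Set.Ioi (0 : ℝ),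
            ENNReal.ofReal r * (Set.Ioi (0 : ℝ)).indicator (fun s =>
            ENNReal.ofReal s * f !₂[s * Real.cos φ, s * Real.sin φ, r * Real.cos θ])
              (r * Real.sin θ) := by
          rw [← lintegral_comp_polarCoord_symm, polarCoord_target, Measure.volume_eq_prod,
            ← Measure.prod_restrict, lintegral_prod_symm]
          · rfl
          · refine Measurable.aemeasurable ?_
            simp only [polarCoord_symm_apply, smul_eq_mul]
            refine Measurable.mul (by fun_prop) ?_
            exact hm.comp (g := fun q => (Set.Ioi (0 : ℝ)).indicator (fun r =>
              ENNReal.ofReal r * f !₂[r * Real.cos φ, r * Real.sin φ, q.1]) q.2)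
              (f := fun p : ℝ × ℝ => (p.1 * Real.cos p.2, p.1 * Real.sin p.2)) (by fun_prop)
      _ = ∫⁻ θ in Set.Ioo (-Real.pi) Real.pi, (Set.Ioo 0 Real.pi).indicator (fun θ =>
            ENNReal.ofReal (Real.sin θ) *
        ∫⁻ r in Set.Ioi (0 : ℝ), ENNReal.ofReal (r ^ 2) *
        f (r • (sphericalPoint (θ, φ) : EuclideanSpace ℝ (Fin 3)))) θ := by
          refine setLIntegral_congr_fun measurableSet_Ioo fun θ hθ => ?_
          by_cases h : 0 < θ
          · have hs : 0 < Real.sin θ := Real.sin_pos_of_pos_of_lt_pi h hθ.2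
            rw [Set.indicator_of_mem (show θ ∈ Set.Ioo 0 Real.pi from ⟨h, hθ.2⟩),
              ← lintegral_const_mul' _ _ ENNReal.ofReal_ne_top]
            refine setLIntegral_congr_fun measurableSet_Ioi fun r hr => ?_
            have hr' : 0 < r := hr
            rw [Set.indicator_of_mem (show r * Real.sin θ ∈ Set.Ioi (0 : ℝ) from mul_pos hr' hs),
              ENNReal.ofReal_mul hr'.le, pow_two, ENNReal.ofReal_mul hr'.le]
            have : r • (sphericalPoint (θ, φ) : EuclideanSpace ℝ (Fin 3)) =
                !₂[r * Real.sin θ * Real.cos φ, r * Real.sin θ * Real.sin φ, r * Real.cos θ] := by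
              ext i
              fin_cases i <;> simp [sphericalPoint, mul_assoc]
            rw [this]
            ring
          · rw [Set.indicator_of_notMem (fun h' => h h'.1)]
            have hs : Real.sin θ ≤ 0 := Real.sin_nonpos_of_nonpos_of_neg_pi_le (not_lt.1 h) hθ.1.le
            rw [setLIntegral_congr_fun (g := fun _ => 0) measurableSet_Ioi, lintegral_zero]
            intro r hr
            have hr' : 0 < r := hr
            dsimp only
            rw [Set.indicator_of_notMem, mul_zero]
            exact not_lt.2 (mul_nonpos_of_nonneg_of_nonpos hr'.le hs)
      _ = _ := by
          rw [setLIntegral_indicator measurableSet_Ioo, Set.inter_eq_left.2]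
          exact Set.Ioo_subset_Ioo_left (by linarith [Real.pi_pos])
  have hmeas3 : Measurable (fun q : (ℝ × ℝ) × ℝ => ENNReal.ofReal q.2 *
      f !₂[q.2 * Real.cos q.1.2, q.2 * Real.sin q.1.2, q.1.1]) :=
    Measurable.mul (by fun_prop) (hf.comp (hpt3 (fun q =>
      (q.2 * Real.cos q.1.2, q.2 * Real.sin q.1.2, q.1.1)) (by fun_prop)))
  have hmeas4 : Measurable (fun p : ℝ × ℝ => ENNReal.ofReal (Real.sin p.1) *
      ∫⁻ r in Set.Ioi (0 : ℝ), ENNReal.ofReal (r ^ 2) *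
        f (r • (sphericalPoint p : EuclideanSpace ℝ (Fin 3)))) := by
    refine Measurable.mul (by fun_prop) ?_
    refine Measurable.lintegral_prod_right' (f := fun q : (ℝ × ℝ) × ℝ => ENNReal.ofReal (q.2 ^ 2) *
        f (q.2 • (sphericalPoint q.1 : EuclideanSpace ℝ (Fin 3)))) ?_
    refine Measurable.mul (by fun_prop) (hf.comp ?_)
    have := continuous_sphericalPoint
    exact Continuous.measurable (by fun_prop)
  simp_rw [step1]
  rw [lintegral_lintegral_swap]
  · simp_rw [step2]
    rw [Measure.volume_eq_prod, ← Measure.prod_restrict, lintegral_prod_symm _ hmeas4.aemeasurable]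
  · exact (hmeas3.lintegral_prod_right').aemeasurable

/-- The law of the polar angle on the sphere, with total mass two. -/
noncomputable def polarAngleMeasure : Measure ℝ :=
  (volume.restrict (Set.Ioo 0 Real.pi)).withDensity fun θ => ENNReal.ofReal (Real.sin θ)

instance : SFinite polarAngleMeasure := by unfold polarAngleMeasure; infer_instance

open scoped Pointwise in
-- `toSphere` is the dimension times the volume of the cone over a set in the unit ball. In
-- spherical coordinates the radial factor of that volume is `∫ r² = 1/3` over `(0, 1)`, which
-- cancels the dimension 3.
theorem toSphere_eq_map_sphericalPoint :
    (volume : Measure (EuclideanSpace ℝ (Fin 3))).toSphere =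
      (polarAngleMeasure.prod (volume.restrict (Set.Ioo (-Real.pi) Real.pi))).map
        sphericalPoint := by
  have hint : ∫⁻ r in Set.Ioo (0 : ℝ) 1, ENNReal.ofReal (r ^ 2) = ENNReal.ofReal (1 / 3) := by
    rw [← ofReal_integral_eq_lintegral_ofReal]
    · rw [← integral_Ioc_eq_integral_Ioo, ← intervalIntegral.integral_of_le zero_le_one]
      norm_num [integral_pow]
    · exact (Continuous.integrableOn_Icc (by fun_prop)).mono_set Set.Ioo_subset_Icc_self
    · exact Filter.Eventually.of_forall fun r => sq_nonneg r
  ext s hs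
  rw [Measure.toSphere_apply' _ hs, Measure.map_apply continuous_sphericalPoint.measurable hs]
  set K : Set (EuclideanSpace ℝ (Fin 3)) := Set.Ioo (0 : ℝ) 1 • (Subtype.val '' s) with hK
  have hmem : ∀ r : ℝ, 0 < r → ∀ u : UnitSphere,
      (r • (u : EuclideanSpace ℝ (Fin 3)) ∈ K ↔ r < 1 ∧ u ∈ s) := by
    intro r hr u
    constructor
    · rintro ⟨t, ht, _, ⟨v, hv, rfl⟩, h⟩
      have h' : t • (v : EuclideanSpace ℝ (Fin 3)) = r • (u : EuclideanSpace ℝ (Fin 3)) := h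
      have hn := congrArg norm h'
      rw [norm_smul, norm_smul, norm_eq_of_mem_sphere, norm_eq_of_mem_sphere, mul_one, mul_one,
        Real.norm_of_nonneg ht.1.le, Real.norm_of_nonneg hr.le] at hn
      subst hn
      have : v = u := Subtype.ext (smul_right_injective _ hr.ne' h')
      exact ⟨ht.2, this ▸ hv⟩
    · rintro ⟨h1, hu⟩
      exact Set.smul_mem_smul ⟨hr, h1⟩ ⟨u, hu, rfl⟩
  -- The cone corresponds to a product set under the homeomorphism of the punctured space with
  -- sphere times half-line.
  have hKm : MeasurableSet K := by
    have : K = Subtype.val '' (homeomorphUnitSphereProd (EuclideanSpace ℝ (Fin 3)) ⁻¹'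
        (s ×ˢ Set.Iio (⟨1, Set.mem_Ioi.2 one_pos⟩ : Set.Ioi (0 : ℝ)))) := by
      ext x
      simp only [Set.mem_image, Set.mem_preimage, Set.mem_prod, Set.mem_Iio]
      constructor
      · rintro ⟨t, ht, _, ⟨v, hv, rfl⟩, h⟩
        refine ⟨(homeomorphUnitSphereProd _).symm (v, ⟨t, ht.1⟩), ?_, h⟩
        rw [Homeomorph.apply_symm_apply]
        exact ⟨hv, ht.2⟩
      · rintro ⟨y, ⟨h1, h2⟩, rfl⟩
        set q := homeomorphUnitSphereProd (EuclideanSpace ℝ (Fin 3)) y with hq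
        have hy : y = (homeomorphUnitSphereProd _).symm q := by simp [hq]
        rw [hy]
        exact Set.smul_mem_smul ⟨q.2.2, h2⟩ ⟨q.1, h1, rfl⟩
    rw [this]
    exact (MeasurableEmbedding.subtype_coe (measurableSet_singleton _).compl).measurableSet_image.2
      ((Homeomorph.measurable _) (hs.prod measurableSet_Iio))
  have hsm : MeasurableSet (sphericalPoint ⁻¹' s) := continuous_sphericalPoint.measurable hs
  have hvol : volume K = ∫⁻ p in Set.Ioo 0 Real.pi ×ˢ Set.Ioo (-Real.pi) Real.pi,
      ENNReal.ofReal (1 / 3) * (ENNReal.ofReal (Real.sin p.1) *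
        (sphericalPoint ⁻¹' s).indicator 1 p) := by
    rw [← lintegral_indicator_one hKm, lintegral_spherical (measurable_one.indicator hKm)]
    refine lintegral_congr fun p => ?_
    rw [setLIntegral_congr_fun (g := (Set.Iio (1 : ℝ)).indicator fun r =>
        (sphericalPoint ⁻¹' s).indicator 1 p * ENNReal.ofReal (r ^ 2)) measurableSet_Ioi,
      setLIntegral_indicator measurableSet_Iio, Set.Iio_inter_Ioi, lintegral_const_mul' _ _ ?_,
      hint]
    · ring
    · by_cases h : p ∈ sphericalPoint ⁻¹' s <;> simp [h]
    · intro r hr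
      have hr' : 0 < r := hr
      by_cases h : r < 1 <;> by_cases h2 : sphericalPoint p ∈ s <;>
        simp [Set.indicator, hmem r hr', h, h2]
  rw [hvol, lintegral_const_mul' _ _ ENNReal.ofReal_ne_top, ← mul_assoc]
  have h3 : ((Module.finrank ℝ (EuclideanSpace ℝ (Fin 3)) : ℕ) : ENNReal) *
      ENNReal.ofReal (1 / 3) = 1 := by
    rw [finrank_euclideanSpace_fin, ← ENNReal.ofReal_natCast, ← ENNReal.ofReal_mul (by norm_num)]
    norm_num
  rw [h3, one_mul, Measure.volume_eq_prod, ← Measure.prod_restrict, ← lintegral_indicator_one hsm,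
    lintegral_prod, lintegral_prod, polarAngleMeasure,
    lintegral_withDensity_eq_lintegral_mul _ (by fun_prop)]
  · refine lintegral_congr fun θ => ?_
    simp only [Pi.mul_apply]
    rw [lintegral_const_mul' _ _ ENNReal.ofReal_ne_top]
  · exact (measurable_one.indicator hsm).lintegral_prod_right'
  · exact (measurable_one.indicator hsm).aemeasurable
  · exact (Measurable.mul (by fun_prop) (measurable_one.indicator hsm)).aemeasurable

/-! ### Invariance under linear isometries -/

/-- The action of a linear isometry of the space on the unit sphere. -/
noncomputable def sphereMap (L : EuclideanSpace ℝ (Fin 3) ≃ₗᵢ[ℝ] EuclideanSpace ℝ (Fin 3)) (u : UnitSphere) :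
    UnitSphere :=
  ⟨L u, by simp⟩

theorem measurable_sphereMap
    (L : EuclideanSpace ℝ (Fin 3) ≃ₗᵢ[ℝ] EuclideanSpace ℝ (Fin 3)) :
    Measurable (sphereMap L) :=
  ((L.continuous.comp continuous_subtype_val).subtype_mk _).measurable

open scoped Pointwise in
theorem measurePreserving_sphereMap_toSphere
    (L : EuclideanSpace ℝ (Fin 3) ≃ₗᵢ[ℝ] EuclideanSpace ℝ (Fin 3)) :
    MeasurePreserving (sphereMap L) (volume : Measure (EuclideanSpace ℝ (Fin 3))).toSphere
      (volume : Measure (EuclideanSpace ℝ (Fin 3))).toSphere := by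
  refine ⟨measurable_sphereMap L, ?_⟩
  ext s hs
  rw [Measure.map_apply (measurable_sphereMap L) hs, Measure.toSphere_apply' _ hs,
    Measure.toSphere_apply' _ (measurable_sphereMap L hs)]
  congr 1
  have : Set.Ioo (0 : ℝ) 1 • (Subtype.val '' (sphereMap L ⁻¹' s)) =
      L.toMeasurableEquiv ⁻¹' (Set.Ioo (0 : ℝ) 1 • (Subtype.val '' s)) := by
    ext x
    constructor
    · rintro ⟨t, ht, _, ⟨v, hv, rfl⟩, rfl⟩
      refine ⟨t, ht, _, ⟨sphereMap L v, hv, rfl⟩, ?_⟩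
      simp [sphereMap]
    · rintro ⟨t, ht, _, ⟨v, hv, rfl⟩, h⟩
      have hv' : sphereMap L (sphereMap L.symm v) = v := Subtype.ext (by simp [sphereMap])
      refine ⟨t, ht, _, ⟨sphereMap L.symm v, by rwa [Set.mem_preimage, hv'], rfl⟩, ?_⟩
      have h' : t • (v : EuclideanSpace ℝ (Fin 3)) = L x := h
      simp [sphereMap, ← map_smul, h']
  rw [this]
  exact L.measurePreserving.measure_preimage_equiv _

theorem measurePreserving_sphereMap
    (L : EuclideanSpace ℝ (Fin 3) ≃ₗᵢ[ℝ] EuclideanSpace ℝ (Fin 3)) :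
    MeasurePreserving (sphereMap L) uniformSphere uniformSphere :=
  (measurePreserving_sphereMap_toSphere L).smul_measure _

/-- The reflection in the plane orthogonal to `u - v` exchanges two vectors of equal norm. Sides and
angles are unoriented, so reflections serve as well as rotations. -/
theorem exists_sphereMap_eq (u v : UnitSphere) :
    ∃ L : EuclideanSpace ℝ (Fin 3) ≃ₗᵢ[ℝ] EuclideanSpace ℝ (Fin 3), sphereMap L u = v :=
  ⟨_, Subtype.ext (Submodule.reflection_sub (by simp))⟩

theorem sphericalSide_sphereMap
    (L : EuclideanSpace ℝ (Fin 3) ≃ₗᵢ[ℝ] EuclideanSpace ℝ (Fin 3)) (Q R : UnitSphere) :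
    sphericalSide (sphereMap L Q) (sphereMap L R) = sphericalSide Q R :=
  L.toLinearIsometry.angle_map _ _

theorem arcDirection_sphereMap
    (L : EuclideanSpace ℝ (Fin 3) ≃ₗᵢ[ℝ] EuclideanSpace ℝ (Fin 3)) (Q R : UnitSphere) :
    arcDirection (sphereMap L Q) (sphereMap L R) = L (arcDirection Q R) := by
  simp [arcDirection, sphereMap]

theorem sphericalAngle_sphereMap
    (L : EuclideanSpace ℝ (Fin 3) ≃ₗᵢ[ℝ] EuclideanSpace ℝ (Fin 3)) (Q R S : UnitSphere) :
    sphericalAngle (sphereMap L Q) (sphereMap L R) (sphereMap L S) = sphericalAngle Q R S := by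
  rw [sphericalAngle, arcDirection_sphereMap, arcDirection_sphereMap]
  exact L.toLinearIsometry.angle_map _ _

/-! ### Spherical trigonometry in terms of inner products -/

theorem inner_arcDirection (P Q R : UnitSphere) :
    inner ℝ (arcDirection P Q) (arcDirection P R) =
      inner ℝ (Q : EuclideanSpace ℝ (Fin 3)) (R : EuclideanSpace ℝ (Fin 3)) -
        inner ℝ (P : EuclideanSpace ℝ (Fin 3)) (Q : EuclideanSpace ℝ (Fin 3)) *
          inner ℝ (P : EuclideanSpace ℝ (Fin 3)) (R : EuclideanSpace ℝ (Fin 3)) := by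
  have hP : inner ℝ (P : EuclideanSpace ℝ (Fin 3)) (P : EuclideanSpace ℝ (Fin 3)) = 1 := by
    rw [real_inner_self_eq_norm_sq, norm_eq_of_mem_sphere, one_pow]
  simp only [arcDirection, inner_sub_left, inner_sub_right, real_inner_smul_left,
    real_inner_smul_right, hP]
  rw [real_inner_comm (P : EuclideanSpace ℝ (Fin 3)) (Q : EuclideanSpace ℝ (Fin 3))]
  ring

theorem norm_arcDirection (P Q : UnitSphere) :
    ‖arcDirection P Q‖ =
      √(1 - inner ℝ (P : EuclideanSpace ℝ (Fin 3)) (Q : EuclideanSpace ℝ (Fin 3)) ^ 2) := by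
  have hQ : inner ℝ (Q : EuclideanSpace ℝ (Fin 3)) (Q : EuclideanSpace ℝ (Fin 3)) = 1 := by
    rw [real_inner_self_eq_norm_sq, norm_eq_of_mem_sphere, one_pow]
  rw [norm_eq_sqrt_real_inner, inner_arcDirection, hQ, pow_two]

/-- The spherical law of cosines, solved for the angle. It holds for degenerate triangles too, with
the same division by zero on both sides. -/
theorem sphericalAngle_eq (P Q R : UnitSphere) :
    sphericalAngle P Q R = Real.arccos
      ((inner ℝ (Q : EuclideanSpace ℝ (Fin 3)) (R : EuclideanSpace ℝ (Fin 3)) -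
        inner ℝ (P : EuclideanSpace ℝ (Fin 3)) (Q : EuclideanSpace ℝ (Fin 3)) *
          inner ℝ (P : EuclideanSpace ℝ (Fin 3)) (R : EuclideanSpace ℝ (Fin 3))) /
      (√(1 - inner ℝ (P : EuclideanSpace ℝ (Fin 3)) (Q : EuclideanSpace ℝ (Fin 3)) ^ 2) *
        √(1 - inner ℝ (P : EuclideanSpace ℝ (Fin 3)) (R : EuclideanSpace ℝ (Fin 3)) ^ 2))) := by
  rw [sphericalAngle, InnerProductGeometry.angle, inner_arcDirection, norm_arcDirection,
    norm_arcDirection]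

theorem sphericalSide_eq (Q R : UnitSphere) :
    sphericalSide Q R =
      Real.arccos (inner ℝ (Q : EuclideanSpace ℝ (Fin 3)) (R : EuclideanSpace ℝ (Fin 3))) := by
  simp [sphericalSide, InnerProductGeometry.angle]

theorem measurable_sphericalAngle {X : Type*} [MeasurableSpace X] {f g h : X → UnitSphere}
    (hf : Measurable f) (hg : Measurable g) (hh : Measurable h) :
    Measurable fun x => sphericalAngle (f x) (g x) (h x) := by
  simp only [sphericalAngle_eq]
  fun_prop

theorem measurable_sphericalSide {X : Type*} [MeasurableSpace X] {f g : X → UnitSphere}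
    (hf : Measurable f) (hg : Measurable g) :
    Measurable fun x => sphericalSide (f x) (g x) := by
  simp only [sphericalSide_eq]
  fun_prop

/-- The angle opposite to the side `a` in a spherical triangle in which the sides `a` and `c`
enclose an angle with cosine `t`. -/
noncomputable def oppositeAngle (a c t : ℝ) : ℝ :=
  Real.arccos ((Real.cos a - Real.cos c * (Real.cos a * Real.cos c + Real.sin a * Real.sin c * t)) /
    (Real.sin c * √(1 - (Real.cos a * Real.cos c + Real.sin a * Real.sin c * t) ^ 2)))

theorem measurable_oppositeAngle {X : Type*} [MeasurableSpace X] {f g h : X → ℝ}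
    (hf : Measurable f) (hg : Measurable g) (hh : Measurable h) :
    Measurable fun x => oppositeAngle (f x) (g x) (h x) := by
  unfold oppositeAngle
  fun_prop

theorem inner_sphericalPoint (p q : ℝ × ℝ) :
    inner ℝ (sphericalPoint p : EuclideanSpace ℝ (Fin 3)) (sphericalPoint q) =
      Real.cos q.1 * Real.cos p.1 + Real.sin q.1 * Real.sin p.1 * Real.cos (p.2 - q.2) := by
  simp [sphericalPoint, PiLp.inner_apply, Fin.sum_univ_three, Real.cos_sub]
  ring

theorem inner_northPole_sphericalPoint (q : ℝ × ℝ) :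
    inner ℝ (sphericalPoint (0, 0) : EuclideanSpace ℝ (Fin 3)) (sphericalPoint q) =
      Real.cos q.1 := by
  simp [inner_sphericalPoint]

theorem sqrt_one_sub_cos_sq {θ : ℝ} (hθ : θ ∈ Set.Ioo 0 Real.pi) :
    √(1 - Real.cos θ ^ 2) = Real.sin θ := by
  rw [← Real.sin_sq, Real.sqrt_sq (Real.sin_pos_of_mem_Ioo hθ).le]

/-- The difference of two azimuths can leave `[0, π]`; `arccos ∘ cos` folds it back to an unoriented
angle. -/
theorem sphericalAngle_northPole {p q : ℝ × ℝ} (hp : p.1 ∈ Set.Ioo 0 Real.pi)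
    (hq : q.1 ∈ Set.Ioo 0 Real.pi) :
    sphericalAngle (sphericalPoint (0, 0)) (sphericalPoint q) (sphericalPoint p) =
      Real.arccos (Real.cos (p.2 - q.2)) := by
  have h1 := (Real.sin_pos_of_mem_Ioo hp).ne'
  have h2 := (Real.sin_pos_of_mem_Ioo hq).ne'
  rw [sphericalAngle_eq, inner_northPole_sphericalPoint, inner_northPole_sphericalPoint,
    inner_sphericalPoint, sqrt_one_sub_cos_sq hp, sqrt_one_sub_cos_sq hq, ← Real.cos_neg (q.2 - p.2),
    neg_sub]
  congr 1
  field_simp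
  ring

theorem sphericalSide_northPole {q : ℝ × ℝ} (hq : q.1 ∈ Set.Ioo 0 Real.pi) :
    sphericalSide (sphericalPoint (0, 0)) (sphericalPoint q) = q.1 := by
  rw [sphericalSide_eq, inner_northPole_sphericalPoint, Real.arccos_cos hq.1.le hq.2.le]

theorem sphericalAngle_opposite_northPole {p : ℝ × ℝ} (hp : p.1 ∈ Set.Ioo 0 Real.pi) (q : ℝ × ℝ) :
    sphericalAngle (sphericalPoint p) (sphericalPoint (0, 0)) (sphericalPoint q) =
      oppositeAngle q.1 p.1 (Real.cos (p.2 - q.2)) := by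
  rw [sphericalAngle_eq, real_inner_comm (sphericalPoint (0, 0) : EuclideanSpace ℝ (Fin 3))
    (sphericalPoint p), inner_northPole_sphericalPoint, inner_northPole_sphericalPoint, inner_sphericalPoint, sqrt_one_sub_cos_sq hp, oppositeAngle]

/-! ### Joint law of an angle and its enclosing sides -/

/-- The integrand is periodic, so the shift by `x` is immaterial, and even, so half a period
suffices. This is why the folded azimuth difference is uniform on `(0, π)`. -/
theorem lintegral_Ioo_cos_sub (g : ℝ → ENNReal) (x : ℝ) :
    ∫⁻ y in Set.Ioo (-Real.pi) Real.pi, g (Real.cos (x - y)) =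
      2 * ∫⁻ y in Set.Ioo 0 Real.pi, g (Real.cos y) := by
  have hpi := Real.pi_pos
  set h : ℝ → ENNReal := fun y => g (Real.cos y) with hh
  have h1 : ∫⁻ y in Set.Ioo (-Real.pi) Real.pi, h (x - y) =
      ∫⁻ y in Set.Ioo (x - Real.pi) (x + Real.pi), h y := by
    have := (Measure.measurePreserving_sub_left volume x).setLIntegral_comp_preimage_emb
      (MeasurableEquiv.subLeft x).measurableEmbedding h (Set.Ioo (x - Real.pi) (x + Real.pi))
    rw [← this]
    congr 2
    ext y
    simp only [Set.mem_Ioo, Set.mem_preimage]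
    constructor <;> rintro ⟨_, _⟩ <;> constructor <;> linarith
  have h2 : ∫⁻ y in Set.Ioo (x - Real.pi) (x + Real.pi), h y =
      ∫⁻ y in Set.Ioo (-Real.pi) Real.pi, h y := by
    have := (isAddFundamentalDomain_Ioc Real.two_pi_pos (x - Real.pi)).setLIntegral_eq
      (isAddFundamentalDomain_Ioc Real.two_pi_pos (-Real.pi)) h (by
        rintro ⟨_, n, rfl⟩ y
        have : (n : ℝ) * (2 * Real.pi) + y = y + n * (2 * Real.pi) := by ring
        simp [hh, AddSubgroup.vadd_def, this])
    rw [setLIntegral_congr Ioo_ae_eq_Ioc, setLIntegral_congr (Ioo_ae_eq_Ioc (a := -Real.pi))]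
    rwa [show x - Real.pi + 2 * Real.pi = x + Real.pi by ring,
      show -Real.pi + 2 * Real.pi = Real.pi by ring] at this
  have h3 : ∫⁻ y in Set.Ioo (-Real.pi) 0, h y = ∫⁻ y in Set.Ioo 0 Real.pi, h y := by
    have := (Measure.measurePreserving_neg (volume : Measure ℝ)).setLIntegral_comp_preimage_emb
      (MeasurableEquiv.neg ℝ).measurableEmbedding h (Set.Ioo 0 Real.pi)
    rw [← this]
    simp [hh]
  change ∫⁻ y in Set.Ioo (-Real.pi) Real.pi, h (x - y) = _
  rw [h1, h2, ← Set.Ioo_union_Ico_eq_Ioo (neg_neg_of_pos hpi) hpi.le,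
    lintegral_union measurableSet_Ico, h3, setLIntegral_congr Ioo_ae_eq_Ico.symm, two_mul]
  exact Set.disjoint_left.2 fun y hy hy' => not_lt.2 hy'.1 hy.2

theorem lintegral_lintegral_Ioo_cos_sub (g : ℝ → ENNReal) :
    ∫⁻ x in Set.Ioo (-Real.pi) Real.pi, ∫⁻ y in Set.Ioo (-Real.pi) Real.pi,
      g (Real.cos (x - y)) =
      ENNReal.ofReal (4 * Real.pi) * ∫⁻ y in Set.Ioo 0 Real.pi, g (Real.cos y) := by
  simp_rw [lintegral_Ioo_cos_sub]
  rw [setLIntegral_const, Real.volume_Ioo, mul_comm, ← mul_assoc,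
    show (4 : ℝ) * Real.pi = (Real.pi - -Real.pi) * 2 by ring, ENNReal.ofReal_mul (q := 2)
      (by linarith [Real.pi_pos])]
  simp

theorem polarAngleMeasure_univ : polarAngleMeasure Set.univ = 2 := by
  rw [polarAngleMeasure, withDensity_apply _ .univ, Measure.restrict_univ,
    ← ofReal_integral_eq_lintegral_ofReal]
  · rw [← integral_Ioc_eq_integral_Ioo, ← intervalIntegral.integral_of_le Real.pi_pos.le]
    norm_num [integral_sin]
  · exact (Continuous.integrableOn_Icc (by fun_prop)).mono_set Set.Ioo_subset_Icc_self
  · exact (ae_restrict_mem measurableSet_Ioo).mono fun θ hθ => (Real.sin_pos_of_mem_Ioo hθ).le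

instance : IsFiniteMeasure polarAngleMeasure := ⟨by rw [polarAngleMeasure_univ]; simp⟩

theorem ae_polarAngleMeasure_mem : ∀ᵐ θ ∂polarAngleMeasure, θ ∈ Set.Ioo 0 Real.pi :=
  (withDensity_absolutelyContinuous _ _).ae_le (ae_restrict_mem measurableSet_Ioo)

theorem toSphere_univ :
    (volume : Measure (EuclideanSpace ℝ (Fin 3))).toSphere Set.univ =
      ENNReal.ofReal (4 * Real.pi) := by
  rw [toSphere_eq_map_sphericalPoint, Measure.map_apply continuous_sphericalPoint.measurable .univ,
    Set.preimage_univ, ← Set.univ_prod_univ, Measure.prod_prod, polarAngleMeasure_univ,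
    Measure.restrict_apply_univ, Real.volume_Ioo,
    show (4 : ℝ) * Real.pi = 2 * (Real.pi - -Real.pi) by ring, ENNReal.ofReal_mul (by norm_num)]
  simp

instance : IsProbabilityMeasure uniformSphere := ⟨by
  rw [uniformSphere, Measure.smul_apply, smul_eq_mul, toSphere_univ]
  exact ENNReal.inv_mul_cancel (by simp [Real.pi_pos]) ENNReal.ofReal_ne_top⟩

/-- The joint law of the angle `β` and of the sides `a` and `c` that enclose it. -/
noncomputable def angleSidesMeasure : Measure (ℝ × ℝ × ℝ) :=
  (ENNReal.ofReal (4 * Real.pi))⁻¹ • (volume.restrict (Set.Ioo 0 Real.pi)).prod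
    (polarAngleMeasure.prod polarAngleMeasure)

/-- The case of `B` at the north pole, with `x = (A, C)`. Polar angles become the sides `c` and `a`,
and the two azimuths enter only through the cosine of their difference. -/
theorem lintegral_uniformSphere_prod {f : ℝ × ℝ → ENNReal} (hf : Measurable f) :
    ∫⁻ x : UnitSphere × UnitSphere,
      f (sphericalAngle (sphericalPoint (0, 0)) x.2 x.1,
        sphericalAngle x.1 (sphericalPoint (0, 0)) x.2 * sphericalSide (sphericalPoint (0, 0)) x.2)
      ∂(uniformSphere.prod uniformSphere) =
    ∫⁻ q, f (q.1, oppositeAngle q.2.1 q.2.2 (Real.cos q.1) * q.2.1) ∂angleSidesMeasure := by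
  have hc0 : ENNReal.ofReal (4 * Real.pi) ≠ 0 := by simp [Real.pi_pos]
  set G : ℝ → ℝ → ℝ → ENNReal := fun c a t => f (Real.arccos t, oppositeAngle a c t * a) with hG
  have hF : Measurable fun x : UnitSphere × UnitSphere =>
      f (sphericalAngle (sphericalPoint (0, 0)) x.2 x.1,
        sphericalAngle x.1 (sphericalPoint (0, 0)) x.2 *
          sphericalSide (sphericalPoint (0, 0)) x.2) :=
    hf.comp ((measurable_sphericalAngle measurable_const measurable_snd measurable_fst).prodMk
      ((measurable_sphericalAngle measurable_fst measurable_const measurable_snd).mul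
        (measurable_sphericalSide measurable_const measurable_snd)))
  have hGm : ∀ {X : Type} [MeasurableSpace X] {u v w : X → ℝ}, Measurable u → Measurable v →
      Measurable w → Measurable fun x => G (u x) (v x) (w x) := fun hu hv hw =>
    hf.comp ((Real.measurable_arccos.comp hw).prodMk ((measurable_oppositeAngle hv hu hw).mul hv))
  have hpt := continuous_sphericalPoint.measurable
  have hF2 := hF.comp (hpt.prodMap hpt)
  simp only [Function.comp_def] at hF2
  set ν := polarAngleMeasure.prod (volume.restrict (Set.Ioo (-Real.pi) Real.pi)) with hν
  have hL : ∫⁻ x : UnitSphere × UnitSphere,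
      f (sphericalAngle (sphericalPoint (0, 0)) x.2 x.1,
        sphericalAngle x.1 (sphericalPoint (0, 0)) x.2 * sphericalSide (sphericalPoint (0, 0)) x.2)
      ∂((ν.map sphericalPoint).prod (ν.map sphericalPoint)) =
      ENNReal.ofReal (4 * Real.pi) * ∫⁻ c, ∫⁻ a, ∫⁻ x in Set.Ioo 0 Real.pi, G c a (Real.cos x)
        ∂volume ∂polarAngleMeasure ∂polarAngleMeasure := by
    rw [Measure.map_prod_map _ _ hpt hpt, lintegral_map hF (hpt.prodMap hpt),
      lintegral_prod _ hF2.aemeasurable, hν, lintegral_prod,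
      ← lintegral_const_mul]
    · refine lintegral_congr_ae (ae_polarAngleMeasure_mem.mono fun c hc => ?_)
      dsimp only
      calc _ = ∫⁻ φ in Set.Ioo (-Real.pi) Real.pi, ∫⁻ a, ∫⁻ ψ in Set.Ioo (-Real.pi) Real.pi,
            G c a (Real.cos (φ - ψ)) ∂volume ∂polarAngleMeasure := by
            refine lintegral_congr fun φ => ?_
            rw [lintegral_prod]
            · refine lintegral_congr_ae (ae_polarAngleMeasure_mem.mono fun a ha => ?_)
              refine lintegral_congr fun ψ => ?_
              simp only [Prod.map_apply]
              rw [sphericalAngle_northPole (p := (c, φ)) (q := (a, ψ)) hc ha,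
                sphericalSide_northPole (q := (a, ψ)) ha,
                sphericalAngle_opposite_northPole (p := (c, φ)) hc]
            · exact (hF.comp ((hpt.prodMap hpt).comp (measurable_const.prodMk
                measurable_id))).aemeasurable
        _ = ∫⁻ a, ∫⁻ φ in Set.Ioo (-Real.pi) Real.pi, ∫⁻ ψ in Set.Ioo (-Real.pi) Real.pi,
            G c a (Real.cos (φ - ψ)) ∂volume ∂volume ∂polarAngleMeasure := by
            rw [lintegral_lintegral_swap]
            refine Measurable.aemeasurable (Measurable.lintegral_prod_right'
              (f := fun y : (ℝ × ℝ) × ℝ => G c y.1.2 (Real.cos (y.1.1 - y.2))) ?_)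
            exact hGm (by fun_prop) (by fun_prop) (by fun_prop)
        _ = ∫⁻ a, ENNReal.ofReal (4 * Real.pi) * ∫⁻ x in Set.Ioo 0 Real.pi, G c a (Real.cos x)
            ∂volume ∂polarAngleMeasure := by
            refine lintegral_congr fun a => ?_
            exact lintegral_lintegral_Ioo_cos_sub (fun t => G c a t)
        _ = _ := by
            rw [lintegral_const_mul' _ _ ENNReal.ofReal_ne_top]
    · refine Measurable.lintegral_prod_right' (f := fun y : ℝ × ℝ => ∫⁻ x in Set.Ioo 0 Real.pi,
        G y.1 y.2 (Real.cos x) ∂volume) ?_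
      refine Measurable.lintegral_prod_right' (f := fun y : (ℝ × ℝ) × ℝ =>
        G y.1.1 y.1.2 (Real.cos y.2)) ?_
      exact hGm (by fun_prop) (by fun_prop) (by fun_prop)
    · exact (hF2.lintegral_prod_right').aemeasurable
  have hm : Measurable fun q : ℝ × ℝ × ℝ =>
      f (q.1, oppositeAngle q.2.1 q.2.2 (Real.cos q.1) * q.2.1) :=
    hf.comp (measurable_fst.prodMk ((measurable_oppositeAngle (by fun_prop) (by fun_prop)
      (by fun_prop)).mul (by fun_prop)))
  have hR : ∫⁻ q, f (q.1, oppositeAngle q.2.1 q.2.2 (Real.cos q.1) * q.2.1) ∂angleSidesMeasure =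
      (ENNReal.ofReal (4 * Real.pi))⁻¹ * ∫⁻ c, ∫⁻ a, ∫⁻ x in Set.Ioo 0 Real.pi, G c a (Real.cos x)
        ∂volume ∂polarAngleMeasure ∂polarAngleMeasure := by
    rw [angleSidesMeasure, lintegral_smul_measure, smul_eq_mul, lintegral_prod_symm _
      hm.aemeasurable, lintegral_prod_symm]
    · congr 1
      refine lintegral_congr fun c => ?_
      refine lintegral_congr fun a => ?_
      refine setLIntegral_congr_fun measurableSet_Ioo fun x hx => ?_
      simp [hG, Real.arccos_cos hx.1.le hx.2.le]
    · refine Measurable.aemeasurable (Measurable.lintegral_prod_left' hm)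
  have hu : uniformSphere = (ENNReal.ofReal (4 * Real.pi))⁻¹ • ν.map sphericalPoint := by
    rw [uniformSphere, toSphere_univ, toSphere_eq_map_sphericalPoint]
  rw [hR, hu, Measure.prod_smul_left, Measure.prod_smul_right, lintegral_smul_measure,
    lintegral_smul_measure, hL, smul_eq_mul, smul_eq_mul, ← mul_assoc _ (ENNReal.ofReal _),
    ENNReal.inv_mul_cancel hc0 ENNReal.ofReal_ne_top, one_mul]

/-- The joint law of the angle at `B` and of the product of a side with its opposite angle, for a
uniformly distributed spherical triangle `A B C`. -/
theorem map_sphericalAngle_sphericalAngle_mul_side {Ω : Type*} [MeasurableSpace Ω] {P : Measure Ω}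
    [IsProbabilityMeasure P] {A B C : Ω → UnitSphere}
    (hA : Measurable A) (hB : Measurable B) (hC : Measurable C)
    (hind : iIndepFun ![A, B, C] P)
    (hAu : P.map A = uniformSphere) (hBu : P.map B = uniformSphere)
    (hCu : P.map C = uniformSphere) :
    P.map (fun ω => (sphericalAngle (B ω) (C ω) (A ω),
      sphericalAngle (A ω) (B ω) (C ω) * sphericalSide (B ω) (C ω))) =
    angleSidesMeasure.map
      (fun q => (q.1, oppositeAngle q.2.1 q.2.2 (Real.cos q.1) * q.2.1)) := by
  have hmeas : ∀ i, Measurable (![A, B, C] i) := by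
    intro i; fin_cases i <;> assumption
  have h1 : P.map (fun ω => (A ω, C ω)) = uniformSphere.prod uniformSphere := by
    have : IndepFun A C P := hind.indepFun (i := 0) (j := 2) (by decide)
    rw [(indepFun_iff_map_prod_eq_prod_map_map hA.aemeasurable hC.aemeasurable).1 this, hAu, hCu]
  have h2 : P.map (fun ω => ((A ω, C ω), B ω)) =
      (uniformSphere.prod uniformSphere).prod uniformSphere := by
    have : IndepFun (fun ω => (A ω, C ω)) B P :=
      hind.indepFun_prodMk hmeas 0 2 1 (by decide) (by decide)
    rw [(indepFun_iff_map_prod_eq_prod_map_map (hA.prodMk hC).aemeasurable hB.aemeasurable).1 this,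
      h1, hBu]
  have hmΩ : Measurable fun ω => (sphericalAngle (B ω) (C ω) (A ω),
      sphericalAngle (A ω) (B ω) (C ω) * sphericalSide (B ω) (C ω)) :=
    (measurable_sphericalAngle hB hC hA).prodMk
      ((measurable_sphericalAngle hA hB hC).mul (measurable_sphericalSide hB hC))
  have hmq : Measurable fun q : ℝ × ℝ × ℝ =>
      (q.1, oppositeAngle q.2.1 q.2.2 (Real.cos q.1) * q.2.1) :=
    measurable_fst.prodMk ((measurable_oppositeAngle (by fun_prop) (by fun_prop)
      (by fun_prop)).mul (by fun_prop))
  refine Measure.ext_of_lintegral _ fun f hf => ?_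
  rw [lintegral_map hf hmΩ, lintegral_map hf hmq, ← lintegral_uniformSphere_prod hf]
  set F : (UnitSphere × UnitSphere) × UnitSphere → ENNReal := fun x =>
    f (sphericalAngle x.2 x.1.2 x.1.1,
        sphericalAngle x.1.1 x.2 x.1.2 * sphericalSide x.2 x.1.2) with hF
  have hFm : Measurable F :=
    hf.comp ((measurable_sphericalAngle (by fun_prop) (by fun_prop) (by fun_prop)).prodMk
      ((measurable_sphericalAngle (by fun_prop) (by fun_prop) (by fun_prop)).mul
        (measurable_sphericalSide (by fun_prop) (by fun_prop))))
  -- An isometry taking the pole to `b` preserves the law of `(A, C)` and all sides and angles, so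
  -- the average over `(A, C)` does not depend on the position of `B`.
  have h3 : ∀ b : UnitSphere, ∫⁻ x, F (x, b) ∂(uniformSphere.prod uniformSphere) =
      ∫⁻ x, F (x, sphericalPoint (0, 0)) ∂(uniformSphere.prod uniformSphere) := by
    intro b
    obtain ⟨L, rfl⟩ := exists_sphereMap_eq (sphericalPoint (0, 0)) b
    have hL := (measurePreserving_sphereMap L).prod (measurePreserving_sphereMap L)
    rw [← hL.lintegral_comp (f := fun x => F (x, sphereMap L (sphericalPoint (0, 0))))
      (hFm.comp (measurable_id.prodMk measurable_const))]
    refine lintegral_congr fun x => ?_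
    simp only [hF, Prod.map_fst, Prod.map_snd, sphericalAngle_sphereMap, sphericalSide_sphereMap]
  calc ∫⁻ ω, F ((A ω, C ω), B ω) ∂P
      = ∫⁻ x, F x ∂((uniformSphere.prod uniformSphere).prod uniformSphere) := by
        rw [← h2, lintegral_map hFm ((hA.prodMk hC).prodMk hB)]
    _ = ∫⁻ b, ∫⁻ x, F (x, b) ∂(uniformSphere.prod uniformSphere) ∂uniformSphere :=
        lintegral_prod_symm _ hFm.aemeasurable
    _ = _ := by simp only [h3, lintegral_const, measure_univ, mul_one]; rfl

/-! ### Conditional expectations from a disintegrated joint law -/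

section CondExpVersion

variable {Ω S : Type*} [MeasurableSpace Ω] [MeasurableSpace S] {P : Measure Ω}
  {ν : Measure ℝ} {ρ : Measure S} {X Y : Ω → ℝ} {h : ℝ × S → ℝ}

theorem map_eq_of_map_prodMk_eq [SFinite ν] [IsProbabilityMeasure ρ]
    (hY : Measurable Y) (hh : Measurable h)
    (hmap : P.map (fun ω => (X ω, Y ω)) = (ν.prod ρ).map fun q => (q.1, h q)) :
    P.map X = ν := by
  have := congrArg Measure.fst hmap
  rw [Measure.fst_map_prodMk hY, Measure.fst_map_prodMk hh] at this
  rw [this]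
  exact Measure.fst_prod

theorem integrable_of_map_prodMk_eq
    (hX : Measurable X) (hY : Measurable Y) (hh : Measurable h) (hint : Integrable h (ν.prod ρ))
    (hmap : P.map (fun ω => (X ω, Y ω)) = (ν.prod ρ).map fun q => (q.1, h q)) :
    Integrable Y P := by
  have h1 : Integrable Prod.snd (P.map fun ω => (X ω, Y ω)) := by
    rw [hmap, integrable_map_measure measurable_snd.aestronglyMeasurable
      (measurable_fst.prodMk hh).aemeasurable]
    exact hint
  exact (integrable_map_measure measurable_snd.aestronglyMeasurable
    (hX.prodMk hY).aemeasurable).1 h1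

/-- Disintegration of the joint law of `X` and `Y` gives a version of the conditional expectation
of `Y` given `X`. -/
theorem isCondExpVersion_of_map_prodMk_eq [IsFiniteMeasure P] [SFinite ν] [IsProbabilityMeasure ρ]
    (hX : Measurable X) (hY : Measurable Y) (hh : Measurable h) (hint : Integrable h (ν.prod ρ))
    (hmap : P.map (fun ω => (X ω, Y ω)) = (ν.prod ρ).map fun q => (q.1, h q)) :
    IsCondExpVersion P Y X fun x => ∫ s, h (x, s) ∂ρ := by
  have hm : StronglyMeasurable fun x => ∫ s, h (x, s) ∂ρ :=
    hh.stronglyMeasurable.integral_prod_right'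
  have hXν := map_eq_of_map_prodMk_eq hY hh hmap
  have hmint : Integrable (fun ω => ∫ s, h (X ω, s) ∂ρ) P := by
    have := hint.integral_prod_left
    rw [← hXν] at this
    exact this.comp_measurable hX
  refine ⟨hm.measurable, ae_eq_condExp_of_forall_setIntegral_eq hX.comap_le
    (integrable_of_map_prodMk_eq hX hY hh hint hmap) (fun s _ _ => hmint.integrableOn) ?_
    (hm.measurable.comp (comap_measurable X)).stronglyMeasurable.aestronglyMeasurable⟩
  rintro _ ⟨T, hT, rfl⟩ -
  have h1 : ∫ ω in X ⁻¹' T, (∫ s, h (X ω, s) ∂ρ) ∂P = ∫ x in T, (∫ s, h (x, s) ∂ρ) ∂ν := by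
    rw [← hXν, setIntegral_map hT hm.aestronglyMeasurable hX.aemeasurable]
  -- Both sides are compared through the joint law, under which `Y` is the second coordinate and the
  -- event is a strip over `T`.
  have h2 : ∫ ω in X ⁻¹' T, Y ω ∂P =
      ∫ p in T ×ˢ Set.univ, p.2 ∂(P.map fun ω => (X ω, Y ω)) := by
    rw [setIntegral_map (hT.prod .univ) measurable_snd.aestronglyMeasurable
      (hX.prodMk hY).aemeasurable]
    congr 2
    ext ω
    simp
  have h3 : ∫ p in T ×ˢ Set.univ, p.2 ∂((ν.prod ρ).map fun q => (q.1, h q)) =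
      ∫ q in T ×ˢ Set.univ, h q ∂(ν.prod ρ) := by
    rw [setIntegral_map (hT.prod .univ) measurable_snd.aestronglyMeasurable
      (measurable_fst.prodMk hh).aemeasurable]
    congr 2
  rw [h1, h2, hmap, h3, setIntegral_prod _ hint.integrableOn]
  simp only [Measure.restrict_univ]

/-- Two versions of a conditional expectation agree at a common point of continuity near which the
conditioning variable is uniformly distributed. -/
theorem IsCondExpVersion.eq_of_continuousAt {U : Set ℝ} {c : ENNReal} (hU : IsOpen U) (hc : c ≠ 0)
    (hX : Measurable X) (hXu : P.map X = c • volume.restrict U) {m₁ m₂ : ℝ → ℝ}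
    (h₁ : IsCondExpVersion P Y X m₁) (h₂ : IsCondExpVersion P Y X m₂) {x : ℝ} (hx : x ∈ U)
    (hc₁ : ContinuousAt m₁ x) (hc₂ : ContinuousAt m₂ x) : m₁ x = m₂ x := by
  by_contra hne
  have hae : ∀ᵐ y ∂P.map X, m₁ y = m₂ y :=
    (ae_map_iff hX.aemeasurable (measurableSet_eq_fun h₁.1 h₂.1)).2 (h₁.2.trans h₂.2.symm)
  rw [hXu, Measure.ae_ennreal_smul_measure_iff hc, ae_restrict_iff' hU.measurableSet] at hae
  have hmem : {y | ¬(y ∈ U → m₁ y = m₂ y)} ∈ nhds x := by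
    filter_upwards [hU.mem_nhds hx, (hc₁.ne_iff_eventually_ne hc₂).1 hne] with y hy hy' hy''
    exact hy' (hy'' hy)
  exact (Measure.measure_pos_of_mem_nhds volume hmem).ne' hae

end CondExpVersion

/-! ### The conditional expectation at a right angle -/

/-- The product of the laws of the two sides that enclose an angle. -/
noncomputable def sidesMeasure : Measure (ℝ × ℝ) :=
  (4 : ENNReal)⁻¹ • polarAngleMeasure.prod polarAngleMeasure

instance : IsProbabilityMeasure sidesMeasure := ⟨by
  rw [sidesMeasure, Measure.smul_apply, ← Set.univ_prod_univ, Measure.prod_prod,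
    polarAngleMeasure_univ, smul_eq_mul, show (2 : ENNReal) * 2 = 4 by norm_num]
  exact ENNReal.inv_mul_cancel (by norm_num) (by norm_num)⟩

/-- Splitting the normalization as `4π = π · 4` exhibits a uniform angle independent of the two
sides. -/
theorem angleSidesMeasure_eq :
    angleSidesMeasure = ((ENNReal.ofReal Real.pi)⁻¹ • volume.restrict (Set.Ioo 0 Real.pi)).prod
      sidesMeasure := by
  rw [angleSidesMeasure, sidesMeasure, Measure.prod_smul_left, Measure.prod_smul_right, smul_smul,
    mul_comm (4 : ℝ), ENNReal.ofReal_mul Real.pi_pos.le, ENNReal.mul_inv (by simp) (by simp)]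
  norm_num

theorem ae_sidesMeasure_mem :
    ∀ᵐ s ∂sidesMeasure, s.1 ∈ Set.Ioo 0 Real.pi ∧ s.2 ∈ Set.Ioo 0 Real.pi := by
  refine Measure.ae_smul_measure ?_ _
  exact (Measure.quasiMeasurePreserving_fst.ae ae_polarAngleMeasure_mem).and
    (Measure.quasiMeasurePreserving_snd.ae ae_polarAngleMeasure_mem)

theorem norm_oppositeAngle_mul_le {a : ℝ} (ha : a ∈ Set.Ioo 0 Real.pi) (c t : ℝ) :
    ‖oppositeAngle a c t * a‖ ≤ Real.pi * Real.pi := by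
  rw [norm_mul, oppositeAngle, Real.norm_of_nonneg (Real.arccos_nonneg _), Real.norm_of_nonneg ha.1.le]
  exact mul_le_mul (Real.arccos_le_pi _) ha.2.le ha.1.le Real.pi_pos.le

theorem continuousAt_oppositeAngle {a c : ℝ} (ha : a ∈ Set.Ioo 0 Real.pi)
    (hc : c ∈ Set.Ioo 0 Real.pi) :
    ContinuousAt (fun x => oppositeAngle a c (Real.cos x)) (Real.pi / 2) := by
  have hsa := Real.sin_pos_of_mem_Ioo ha
  have hsc := Real.sin_pos_of_mem_Ioo hc
  refine Real.continuous_arccos.continuousAt.comp (ContinuousAt.div (by fun_prop) (by fun_prop) ?_)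
  rw [Real.cos_pi_div_two]
  -- At a right angle the third side has cosine `cos a cos c` (spherical Pythagoras), so this is
  -- `sin² a + sin² c - sin² a sin² c`.
  have : 0 < 1 - (Real.cos a * Real.cos c + Real.sin a * Real.sin c * 0) ^ 2 := by
    have h1 : Real.cos a ^ 2 = 1 - Real.sin a ^ 2 := Real.cos_sq' a
    have h2 : Real.cos c ^ 2 = 1 - Real.sin c ^ 2 := Real.cos_sq' c
    have h3 : Real.sin c ^ 2 ≤ 1 := Real.sin_sq_le_one c
    rw [mul_zero, add_zero, mul_pow, h1, h2]
    nlinarith [pow_pos hsa 2, pow_pos hsc 2]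
  exact (mul_pos hsc (Real.sqrt_pos.2 this)).ne'

/-- The version obtained by disintegration is continuous at `π/2` by dominated convergence with the
constant bound `π²`; its value there involves `cos (π/2) = 0`. -/
theorem hasCondExpAt_pi_div_two {Ω : Type*} [MeasurableSpace Ω] {P : Measure Ω}
    [IsProbabilityMeasure P] {A B C : Ω → UnitSphere}
    (hA : Measurable A) (hB : Measurable B) (hC : Measurable C)
    (hind : iIndepFun ![A, B, C] P)
    (hAu : P.map A = uniformSphere) (hBu : P.map B = uniformSphere)
    (hCu : P.map C = uniformSphere) :
    HasCondExpAt P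
      (fun ω => sphericalAngle (A ω) (B ω) (C ω) * sphericalSide (B ω) (C ω))
      (fun ω => sphericalAngle (B ω) (C ω) (A ω))
      (Real.pi / 2) (∫ s, oppositeAngle s.1 s.2 0 * s.1 ∂sidesMeasure) := by
  have hX := measurable_sphericalAngle hB hC hA
  have hY := (measurable_sphericalAngle hA hB hC).mul (measurable_sphericalSide hB hC)
  have hmap := map_sphericalAngle_sphericalAngle_mul_side hA hB hC hind hAu hBu hCu
  rw [angleSidesMeasure_eq] at hmap
  set h : ℝ × ℝ × ℝ → ℝ := fun q => oppositeAngle q.2.1 q.2.2 (Real.cos q.1) * q.2.1 with hh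
  have hhm : Measurable h :=
    (measurable_oppositeAngle (by fun_prop) (by fun_prop) (by fun_prop)).mul (by fun_prop)
  set ν := (ENNReal.ofReal Real.pi)⁻¹ • volume.restrict (Set.Ioo 0 Real.pi) with hν
  have : IsFiniteMeasure ν := Measure.smul_finite _ (by simp [Real.pi_pos])
  have hint : Integrable h (ν.prod sidesMeasure) :=
    Integrable.of_bound hhm.aestronglyMeasurable (Real.pi * Real.pi)
      ((Measure.quasiMeasurePreserving_snd.ae ae_sidesMeasure_mem).mono fun q hq =>
        norm_oppositeAngle_mul_le hq.1 _ _)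
  have hver := isCondExpVersion_of_map_prodMk_eq hX hY hhm hint hmap
  have hcont : ContinuousAt (fun x => ∫ s, h (x, s) ∂sidesMeasure) (Real.pi / 2) := by
    refine continuousAt_of_dominated (bound := fun _ => Real.pi * Real.pi)
      (Filter.Eventually.of_forall fun x =>
        (hhm.comp measurable_prodMk_left).aestronglyMeasurable)
      (Filter.Eventually.of_forall fun x => ae_sidesMeasure_mem.mono fun s hs =>
        norm_oppositeAngle_mul_le hs.1 _ _) (integrable_const _)
      (ae_sidesMeasure_mem.mono fun s hs => ?_)
    exact (continuousAt_oppositeAngle hs.1 hs.2).mul continuousAt_const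
  refine ⟨integrable_of_map_prodMk_eq hX hY hhm hint hmap, ⟨_, hver, hcont⟩, fun m hm hmc => ?_⟩
  have hp := Real.pi_pos
  rw [hm.eq_of_continuousAt isOpen_Ioo (by simp) hX (map_eq_of_map_prodMk_eq hY hhm hmap) hver
    (x := Real.pi / 2) ⟨by linarith, by linarith⟩ hmc hcont]
  simp [hh]

/-! ### Integration over the sides -/

theorem integral_polarAngleMeasure (f : ℝ → ℝ) :
    ∫ θ, f θ ∂polarAngleMeasure = ∫ θ in (0 : ℝ)..Real.pi, Real.sin θ * f θ := by
  rw [polarAngleMeasure, integral_withDensity_eq_integral_toReal_smul (by fun_prop)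
    (Filter.Eventually.of_forall fun _ => ENNReal.ofReal_lt_top),
    intervalIntegral.integral_of_le Real.pi_pos.le, integral_Ioc_eq_integral_Ioo]
  refine setIntegral_congr_fun measurableSet_Ioo fun θ hθ => ?_
  simp only [smul_eq_mul]
  rw [ENNReal.toReal_ofReal (Real.sin_pos_of_mem_Ioo hθ).le]

/-- Napier's rule `cot α = cot a sin c` for a right spherical triangle, with `arctan` chosen so that
nothing is singular at `a = π/2`. -/
theorem oppositeAngle_zero {a c : ℝ} (ha : a ∈ Set.Ioo 0 Real.pi) (hc : c ∈ Set.Ioo 0 Real.pi) :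
    oppositeAngle a c 0 =
      Real.pi / 2 - Real.arctan (Real.cos a / Real.sin a * Real.sin c) := by
  have hsa := Real.sin_pos_of_mem_Ioo ha
  have hsc := Real.sin_pos_of_mem_Ioo hc
  set k := Real.cos a / Real.sin a with hk
  have hka : Real.cos a = k * Real.sin a := by rw [hk]; field_simp
  have h1 : 1 - (Real.cos a * Real.cos c + Real.sin a * Real.sin c * 0) ^ 2 =
      Real.sin a ^ 2 * (1 + (k * Real.sin c) ^ 2) := by
    have e1 : Real.sin a ^ 2 = 1 - Real.cos a ^ 2 := Real.sin_sq a
    have e2 : Real.cos c ^ 2 = 1 - Real.sin c ^ 2 := Real.cos_sq' c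
    calc _ = 1 - Real.cos a ^ 2 * Real.cos c ^ 2 := by ring
      _ = (1 - Real.cos a ^ 2) + Real.cos a ^ 2 * Real.sin c ^ 2 := by rw [e2]; ring
      _ = _ := by rw [← e1, hka]; ring
  have hpos : 0 < √(1 + (k * Real.sin c) ^ 2) := Real.sqrt_pos.2 (by positivity)
  rw [oppositeAngle, h1, Real.sqrt_mul (sq_nonneg _), Real.sqrt_sq hsa.le, Real.arctan_eq_arcsin,
    ← Real.arccos_eq_pi_div_two_sub_arcsin]
  congr 1
  have h2 : Real.cos a - Real.cos c *
      (Real.cos a * Real.cos c + Real.sin a * Real.sin c * 0) =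
      k * Real.sin a * Real.sin c ^ 2 := by
    rw [Real.sin_sq c, ← hka]; ring
  rw [h2]
  field_simp

/-- `A ∫ dc / (1 + k² sin² c)`, with `A² = 1 + k²`, has an elementary antiderivative without
singularities. -/
theorem hasDerivAt_add_arctan {A : ℝ} (hA : 0 < A) (x : ℝ) :
    HasDerivAt (fun c => c + Real.arctan ((A - 1) * (Real.sin c * Real.cos c) /
      (Real.cos c ^ 2 + A * Real.sin c ^ 2)))
      (A / (Real.cos x ^ 2 + A ^ 2 * Real.sin x ^ 2)) x := by
  have hcs := Real.sin_sq_add_cos_sq x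
  have hpos : ∀ B : ℝ, 0 < B → 0 < Real.cos x ^ 2 + B * Real.sin x ^ 2 := by
    intro B hB
    rcases eq_or_ne (Real.sin x) 0 with h | h
    · rw [h] at hcs ⊢; nlinarith
    · have : 0 < B * Real.sin x ^ 2 := by positivity
      nlinarith [sq_nonneg (Real.cos x)]
  have hD := hpos A hA
  have hE := hpos (A ^ 2) (by positivity)
  -- The natural antiderivative `arctan (A tan c)` jumps at `π/2`. By the subtraction formula the
  -- arctangent used here is `arctan (A tan c) - c` for small `c`, and its denominator never
  -- vanishes.
  have hN : HasDerivAt (fun c => (A - 1) * (Real.sin c * Real.cos c))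
      ((A - 1) * (Real.cos x * Real.cos x + Real.sin x * -Real.sin x)) x :=
    ((Real.hasDerivAt_sin x).mul (Real.hasDerivAt_cos x)).const_mul _
  have hDd : HasDerivAt (fun c => Real.cos c ^ 2 + A * Real.sin c ^ 2)
      (2 * Real.cos x * -Real.sin x + A * (2 * Real.sin x * Real.cos x)) x := by
    have h1 := (Real.hasDerivAt_cos x).pow 2
    have h2 := ((Real.hasDerivAt_sin x).pow 2).const_mul A
    refine (h1.add h2).congr_deriv ?_
    simp
  have := (hasDerivAt_id x).add ((hN.div hDd hD.ne').arctan)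
  refine this.congr_deriv ?_
  have hsum : (Real.cos x ^ 2 + A * Real.sin x ^ 2) ^ 2 +
      ((A - 1) * (Real.sin x * Real.cos x)) ^ 2 = Real.cos x ^ 2 + A ^ 2 * Real.sin x ^ 2 := by
    rw [Real.cos_sq' x, mul_pow, mul_pow, Real.cos_sq' x]; ring
  have h1 : 1 + ((A - 1) * (Real.sin x * Real.cos x) /
      (Real.cos x ^ 2 + A * Real.sin x ^ 2)) ^ 2 =
      (Real.cos x ^ 2 + A ^ 2 * Real.sin x ^ 2) / (Real.cos x ^ 2 + A * Real.sin x ^ 2) ^ 2 := by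
    rw [← hsum]; field_simp
  simp only [Pi.div_apply]
  rw [h1, eq_div_iff hE.ne']
  set C := Real.cos x ^ 2 + A * Real.sin x ^ 2 with hC
  set E := Real.cos x ^ 2 + A ^ 2 * Real.sin x ^ 2 with hEd
  have : E + ((A - 1) * (Real.cos x * Real.cos x + Real.sin x * -Real.sin x) * C -
      (A - 1) * (Real.sin x * Real.cos x) *
        (2 * Real.cos x * -Real.sin x + A * (2 * Real.sin x * Real.cos x))) = A := by
    have hc2 : Real.cos x * Real.cos x = 1 - Real.sin x ^ 2 := by rw [← Real.cos_sq' x]; ring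
    calc _ = E + (A - 1) * ((Real.cos x * Real.cos x - Real.sin x ^ 2) * C -
          2 * (A - 1) * Real.sin x ^ 2 * (Real.cos x * Real.cos x)) := by ring
      _ = A := by rw [hEd, hC, Real.cos_sq' x, hc2]; ring
  refine Eq.trans ?_ this
  field_simp

/-- Integration by parts leaves `k² cos² c / (1 + k² sin² c) = A² / (1 + k² sin² c) - 1` with `A² =
1 + k²`, to which `hasDerivAt_add_arctan` applies. The boundary terms with `arctan` vanish at `0`
and `π`. -/
theorem mul_integral_sin_mul_arctan (k : ℝ) :
    k * ∫ c in (0 : ℝ)..Real.pi, Real.sin c * Real.arctan (k * Real.sin c) =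
      Real.pi * (√(1 + k ^ 2) - 1) := by
  set A := √(1 + k ^ 2) with hA
  have hApos : 0 < A := Real.sqrt_pos.2 (by positivity)
  have hAsq : A ^ 2 = 1 + k ^ 2 := Real.sq_sqrt (by positivity)
  have hder : ∀ x ∈ Set.uIcc 0 Real.pi, HasDerivAt (fun c =>
      -(k * (Real.cos c * Real.arctan (k * Real.sin c))) +
      (A * (c + Real.arctan ((A - 1) * (Real.sin c * Real.cos c) /
      (Real.cos c ^ 2 + A * Real.sin c ^ 2))) - c))
      (k * (Real.sin x * Real.arctan (k * Real.sin x))) x := by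
    intro x _
    have h1 : HasDerivAt (fun c => k * Real.sin c) (k * Real.cos x) x :=
      (Real.hasDerivAt_sin x).const_mul k
    have h2 := (((Real.hasDerivAt_cos x).mul h1.arctan).const_mul k).neg
    have h3 := ((hasDerivAt_add_arctan hApos x).const_mul A).sub (hasDerivAt_id x)
    refine (h2.add h3).congr_deriv ?_
    have h4 : Real.cos x ^ 2 + A ^ 2 * Real.sin x ^ 2 = 1 + (k * Real.sin x) ^ 2 := by
      rw [hAsq, Real.cos_sq' x]; ring
    rw [h4]
    have h5 : 1 + (k * Real.sin x) ^ 2 ≠ 0 := by positivity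
    field_simp
    have h6 : A ^ 2 = 1 + k ^ 2 * Real.sin x ^ 2 + k ^ 2 * Real.cos x ^ 2 := by
      rw [hAsq, Real.cos_sq' x]; ring
    rw [h6]
    ring
  rw [← intervalIntegral.integral_const_mul,
    intervalIntegral.integral_eq_sub_of_hasDerivAt hder]
  · simp
    ring
  · refine Continuous.intervalIntegrable ?_ _ _
    have := Real.continuous_arctan
    fun_prop

theorem integral_oppositeAngle_zero {a : ℝ} (ha : a ∈ Set.Ioo 0 Real.pi) (ha' : Real.cos a ≠ 0) :
    ∫ c, oppositeAngle a c 0 ∂polarAngleMeasure =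
      Real.pi * (Real.cos a + Real.sin a - 1) / Real.cos a := by
  have hsa := Real.sin_pos_of_mem_Ioo ha
  set k := Real.cos a / Real.sin a with hk
  have hk0 : k ≠ 0 := div_ne_zero ha' hsa.ne'
  have hsqrt : √(1 + k ^ 2) = 1 / Real.sin a := by
    rw [Real.sqrt_eq_iff_mul_self_eq_of_pos (by positivity), hk]
    field_simp
    rw [Real.sin_sq_add_cos_sq]
  have hcont := Real.continuous_arctan
  calc ∫ c, oppositeAngle a c 0 ∂polarAngleMeasure
      = ∫ c, (Real.pi / 2 - Real.arctan (k * Real.sin c)) ∂polarAngleMeasure :=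
        integral_congr_ae (ae_polarAngleMeasure_mem.mono fun c hc => oppositeAngle_zero ha hc)
    _ = ∫ c in (0 : ℝ)..Real.pi, (Real.pi / 2 * Real.sin c -
          Real.sin c * Real.arctan (k * Real.sin c)) := by
        rw [integral_polarAngleMeasure]
        congr 1
        funext c
        ring
    _ = Real.pi - ∫ c in (0 : ℝ)..Real.pi, Real.sin c * Real.arctan (k * Real.sin c) := by
        rw [intervalIntegral.integral_sub, intervalIntegral.integral_const_mul, integral_sin]
        · norm_num
        · exact Continuous.intervalIntegrable (by fun_prop) _ _
        · exact Continuous.intervalIntegrable (by fun_prop) _ _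
    _ = Real.pi - Real.pi * (1 / Real.sin a - 1) / k := by
        rw [← hsqrt, ← mul_integral_sin_mul_arctan, mul_div_cancel_left₀ _ hk0]
    _ = _ := by
        rw [hk]
        field_simp
        ring

theorem integral_oppositeAngle_mul_side :
    ∫ s, oppositeAngle s.1 s.2 0 * s.1 ∂sidesMeasure = Real.pi / 4 *
      ∫ θ in (0 : ℝ)..Real.pi, θ * Real.tan θ * (Real.cos θ + Real.sin θ - 1) := by
  have hm : Measurable fun s : ℝ × ℝ => oppositeAngle s.1 s.2 0 * s.1 :=
    (measurable_oppositeAngle (by fun_prop) (by fun_prop) (by fun_prop)).mul (by fun_prop)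
  have hint : Integrable (fun s : ℝ × ℝ => oppositeAngle s.1 s.2 0 * s.1)
      (polarAngleMeasure.prod polarAngleMeasure) :=
    Integrable.of_bound hm.aestronglyMeasurable (Real.pi * Real.pi)
      ((Measure.quasiMeasurePreserving_fst.ae ae_polarAngleMeasure_mem).mono fun q hq =>
        norm_oppositeAngle_mul_le hq _ _)
  rw [sidesMeasure, integral_smul_measure, integral_prod _ hint, integral_polarAngleMeasure,
    smul_eq_mul, div_eq_inv_mul, mul_assoc, mul_comm, ← intervalIntegral.integral_const_mul, mul_comm]
  congr 1
  · simp
  · refine intervalIntegral.integral_congr_ae ?_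
    -- At `π/2` the inner integral was not evaluated, since that divides by `k = cot θ`; `π` is the
    -- endpoint missing from the open interval.
    have hne : ∀ᵐ θ : ℝ, θ ≠ Real.pi / 2 ∧ θ ≠ Real.pi :=
      (Measure.ae_ne volume _).and (Measure.ae_ne volume _)
    filter_upwards [hne] with θ hθ hmem
    rw [Set.uIoc_of_le Real.pi_pos.le] at hmem
    have hθ' : θ ∈ Set.Ioo 0 Real.pi := ⟨hmem.1, lt_of_le_of_ne hmem.2 hθ.2⟩
    have hcos : Real.cos θ ≠ 0 := by
      intro h
      apply hθ.1
      refine Real.injOn_cos ⟨hθ'.1.le, hθ'.2.le⟩ ⟨by positivity, by linarith [Real.pi_pos]⟩ ?_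
      rw [h, Real.cos_pi_div_two]
    rw [integral_mul_const, integral_oppositeAngle_zero hθ' hcos, Real.tan_eq_sin_div_cos]
    ring

/-! ### Catalan's constant and the integral of `u tan u` -/

theorem summable_one_div_odd_sq : Summable fun n : ℕ => 1 / (2 * (n : ℝ) + 1) ^ 2 := by
  have := (summable_nat_add_iff 1).2 (Real.summable_one_div_nat_pow.2 (one_lt_two : 1 < 2))
  refine this.of_nonneg_of_le (fun n => by positivity) fun n => ?_
  have : (0 : ℝ) ≤ n := n.cast_nonneg
  refine one_div_le_one_div_of_le (by positivity) (pow_le_pow_left₀ (by positivity) ?_ 2)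
  push_cast
  linarith

theorem hasSum_catalanConstant :
    HasSum (fun k : ℕ => (-1 : ℝ) ^ k / (2 * (k : ℝ) + 1) ^ 2) catalanConstant := by
  refine (Summable.of_norm ?_).hasSum
  simpa using summable_one_div_odd_sq

/-- `dslope` fills in the removable singularity of `arctan x / x` at `0`, which keeps the integrand
continuous under the substitution `x = tan u`. -/
theorem continuous_dslope_arctan : Continuous (dslope Real.arctan 0) := by
  rw [← continuousOn_univ, continuousOn_dslope Filter.univ_mem]
  exact ⟨Real.continuous_arctan.continuousOn, Real.differentiable_arctan _⟩

theorem dslope_arctan_zero_of_ne {x : ℝ} (hx : x ≠ 0) :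
    dslope Real.arctan 0 x = Real.arctan x / x := by
  rw [dslope_of_ne _ hx, slope_def_field, Real.arctan_zero, sub_zero, sub_zero]

/-- Termwise integration of the arctangent series; the integrals of the absolute values are the
summable `1 / (2n + 1)²`. -/
theorem integral_arctan_div_eq_catalanConstant :
    ∫ x in (0 : ℝ)..1, dslope Real.arctan 0 x = catalanConstant := by
  rw [intervalIntegral.integral_of_le zero_le_one]
  set F : ℕ → ℝ → ℝ := fun n x => (-1) ^ n * x ^ (2 * n) / (2 * n + 1) with hF
  have hint : ∀ n, Integrable (F n) (volume.restrict (Set.Ioc 0 1)) := fun n =>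
    (Continuous.integrableOn_Icc (by fun_prop)).mono_set Set.Ioc_subset_Icc_self
  have hpow : ∀ n : ℕ, ∫ x in Set.Ioc (0 : ℝ) 1, x ^ (2 * n) / (2 * n + 1) =
      1 / (2 * (n : ℝ) + 1) ^ 2 := by
    intro n
    rw [← intervalIntegral.integral_of_le zero_le_one, intervalIntegral.integral_div, integral_pow]
    have : (2 * (n : ℝ) + 1) ≠ 0 := by positivity
    push_cast
    field_simp
    simp
  have hnorm : ∀ n, ∫ x in Set.Ioc (0 : ℝ) 1, ‖F n x‖ = 1 / (2 * (n : ℝ) + 1) ^ 2 := by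
    intro n
    rw [← hpow]
    refine setIntegral_congr_fun measurableSet_Ioc fun x hx => ?_
    have : (0 : ℝ) ≤ 2 * n + 1 := by positivity
    simp [hF, abs_of_nonneg this, abs_of_pos hx.1]
  have h1 := hasSum_integral_of_summable_integral_norm hint
    (by simp_rw [hnorm]; exact summable_one_div_odd_sq)
  have h2 : ∀ n, ∫ x in Set.Ioc (0 : ℝ) 1, F n x = (-1 : ℝ) ^ n / (2 * (n : ℝ) + 1) ^ 2 := by
    intro n
    simp only [hF, mul_div_assoc]
    rw [integral_const_mul, hpow]
    ring
  simp_rw [h2] at h1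
  rw [← h1.unique hasSum_catalanConstant]
  refine integral_congr_ae ?_
  filter_upwards [ae_restrict_mem measurableSet_Ioc, Measure.ae_ne _ (1 : ℝ)] with x hx hx1
  have hlt : ‖x‖ < 1 := by
    rw [Real.norm_of_nonneg hx.1.le]
    exact lt_of_le_of_ne hx.2 hx1
  rw [dslope_arctan_zero_of_ne hx.1.ne']
  refine HasSum.tsum_eq (f := fun n => F n x) ?_ |>.symm
  have he : (fun n => F n x) =
      fun n : ℕ => (-1) ^ n * x ^ (2 * n + 1) / ((2 * n + 1 : ℕ) : ℝ) / x := by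
    funext n
    have := hx.1.ne'
    simp only [hF]
    push_cast
    field_simp
    exact (pow_succ _ _).symm
  rw [he]
  exact (Real.hasSum_arctan hlt).div_const x

theorem cos_pos_of_mem_Icc_pi_div_four {u : ℝ} (hu : u ∈ Set.Icc 0 (Real.pi / 4)) :
    0 < Real.cos u :=
  Real.cos_pos_of_mem_Ioo ⟨by linarith [hu.1, Real.pi_pos], by linarith [hu.2, Real.pi_pos]⟩

theorem continuousOn_dslope_arctan_tan :
    ContinuousOn (fun u => dslope Real.arctan 0 (Real.tan u) * (1 / Real.cos u ^ 2))
      (Set.Icc 0 (Real.pi / 4)) := by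
  refine ContinuousOn.mul (continuous_dslope_arctan.comp_continuousOn fun u hu => ?_)
    (ContinuousOn.div (by fun_prop) (by fun_prop) fun u hu => ?_)
  · exact (Real.continuousAt_tan.2 (cos_pos_of_mem_Icc_pi_div_four hu).ne').continuousWithinAt
  · exact pow_ne_zero 2 (cos_pos_of_mem_Icc_pi_div_four hu).ne'

theorem continuousOn_mul_tan : ContinuousOn (fun u => u * Real.tan u) (Set.Icc 0 (Real.pi / 4)) :=
  continuousOn_id.mul fun _ hu =>
    (Real.continuousAt_tan.2 (cos_pos_of_mem_Icc_pi_div_four hu).ne').continuousWithinAt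

theorem integral_dslope_arctan_tan :
    ∫ u in (0 : ℝ)..(Real.pi / 4), dslope Real.arctan 0 (Real.tan u) * (1 / Real.cos u ^ 2) =
      catalanConstant := by
  have hIcc : Set.uIcc 0 (Real.pi / 4) = Set.Icc 0 (Real.pi / 4) :=
    Set.uIcc_of_le (by positivity)
  have := intervalIntegral.integral_comp_mul_deriv' (a := 0) (b := Real.pi / 4) (f := Real.tan)
    (f' := fun u => 1 / Real.cos u ^ 2) (g := dslope Real.arctan 0)
    (fun u hu => Real.hasDerivAt_tan (cos_pos_of_mem_Icc_pi_div_four (hIcc ▸ hu)).ne')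
    (by
      rw [hIcc]
      exact ContinuousOn.div (by fun_prop) (by fun_prop) fun u hu =>
        pow_ne_zero 2 (cos_pos_of_mem_Icc_pi_div_four hu).ne')
    continuous_dslope_arctan.continuousOn
  rw [Real.tan_zero, Real.tan_pi_div_four, integral_arctan_div_eq_catalanConstant] at this
  exact this

/-- Writing `sin 2u = 2u sinc 2u` isolates the singularity at `0` in `2u log 2u`, which is
continuous with the default value `log 0 = 0`. -/
theorem continuousOn_mul_log_sin_two_mul :
    ContinuousOn (fun u => u * Real.log (Real.sin (2 * u))) (Set.Icc 0 (Real.pi / 4)) := by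
  have hpi := Real.pi_pos
  have hs : ∀ u ∈ Set.Icc 0 (Real.pi / 4), Real.sinc (2 * u) ≠ 0 := by
    intro u hu
    rcases eq_or_ne u 0 with rfl | h
    · simp
    · have h0 : 0 < u := lt_of_le_of_ne hu.1 h.symm
      rw [Real.sinc_of_ne_zero (by positivity)]
      exact (div_pos (Real.sin_pos_of_pos_of_lt_pi (by positivity) (by linarith [hu.2]))
        (by positivity)).ne'
  have h1 : ContinuousOn (fun u => 1 / 2 * (2 * u * Real.log (2 * u)) +
      u * Real.log (Real.sinc (2 * u))) (Set.Icc 0 (Real.pi / 4)) := by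
    refine ContinuousOn.add ?_ (continuousOn_id.mul (ContinuousOn.log ?_ hs))
    · exact ((Real.continuous_mul_log.comp (continuous_const.mul continuous_id)).const_smul
        (1 / 2 : ℝ)).continuousOn
    · exact (Real.continuous_sinc.comp (continuous_const.mul continuous_id)).continuousOn
  refine h1.congr fun u hu => ?_
  rcases eq_or_ne u 0 with rfl | h
  · simp
  · have h2 : Real.sin (2 * u) = 2 * u * Real.sinc (2 * u) := by
      rw [Real.sinc_of_ne_zero (by simpa using h)]
      field_simp
    dsimp only
    rw [h2, Real.log_mul (by simpa using h) (hs u hu)]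
    ring

theorem intervalIntegrable_log_sin_two_mul :
    IntervalIntegrable (fun u => Real.log (Real.sin (2 * u))) volume 0 (Real.pi / 4) := by
  have := (intervalIntegrable_log_sin (a := 0) (b := Real.pi / 2)).comp_mul_left (c := 2)
  rwa [zero_div, show Real.pi / 2 / 2 = Real.pi / 4 by ring] at this

theorem integral_log_sin_two_mul :
    ∫ u in (0 : ℝ)..(Real.pi / 4), Real.log (Real.sin (2 * u)) =
      -(Real.pi / 4 * Real.log 2) := by
  rw [intervalIntegral.integral_comp_mul_left (fun v => Real.log (Real.sin v)) two_ne_zero,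
    mul_zero, show 2 * (Real.pi / 4) = Real.pi / 2 by ring, integral_log_sin_zero_pi_div_two,
    smul_eq_mul]
  ring

/-- The function `u log (sin 2u)` vanishes at both endpoints, and its derivative is `log (sin 2u) +
u (cot u - tan u)`. Since `u (cot u + tan u) = u / (tan u cos² u)` integrates to `G`, the log-sine
integral determines the rest. -/
theorem integral_mul_tan :
    ∫ u in (0 : ℝ)..(Real.pi / 4), u * Real.tan u =
      (catalanConstant - Real.pi / 4 * Real.log 2) / 2 := by
  have hpi := Real.pi_pos
  have hle : (0 : ℝ) ≤ Real.pi / 4 := by positivity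
  have hQ := continuousOn_dslope_arctan_tan.intervalIntegrable_of_Icc (μ := volume) hle
  have hT := (continuousOn_mul_tan.intervalIntegrable_of_Icc (μ := volume) hle).const_mul 2
  have hL := intervalIntegrable_log_sin_two_mul
  have hFTC := intervalIntegral.integral_eq_sub_of_hasDerivAt_of_le hle
    continuousOn_mul_log_sin_two_mul
    (f' := fun u => Real.log (Real.sin (2 * u)) +
      (dslope Real.arctan 0 (Real.tan u) * (1 / Real.cos u ^ 2) - 2 * (u * Real.tan u))) ?_
    (hL.add (hQ.sub hT))
  · rw [intervalIntegral.integral_add hL (hQ.sub hT), intervalIntegral.integral_sub hQ hT,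
      integral_log_sin_two_mul, integral_dslope_arctan_tan, intervalIntegral.integral_const_mul,
      show 2 * (Real.pi / 4) = Real.pi / 2 by ring] at hFTC
    simp only [Real.sin_pi_div_two, Real.log_one, mul_zero, zero_mul, sub_zero] at hFTC
    linarith
  · intro u hu
    have hc := cos_pos_of_mem_Icc_pi_div_four ⟨hu.1.le, hu.2.le⟩
    have hs : 0 < Real.sin u := Real.sin_pos_of_pos_of_lt_pi hu.1 (by linarith [hu.2])
    have hs2 : Real.sin (2 * u) ≠ 0 := by
      rw [Real.sin_two_mul]; positivity
    have htan : Real.tan u ≠ 0 := by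
      rw [Real.tan_eq_sin_div_cos]; positivity
    have h2 : HasDerivAt (fun v : ℝ => 2 * v) 2 u := by
      simpa using (hasDerivAt_id u).const_mul 2
    refine ((hasDerivAt_id u).mul (h2.sin.log hs2)).congr_deriv ?_
    rw [dslope_arctan_zero_of_ne htan, Real.arctan_tan (by linarith [hu.1]) (by linarith [hu.2]),
      Real.tan_eq_sin_div_cos, Real.sin_two_mul, Real.cos_two_mul']
    simp only [id]
    field_simp
    linear_combination u * Real.sin_sq_add_cos_sq u

/-! ### Closed form of the integral -/

theorem one_add_sin_pos {θ : ℝ} (hθ : θ ∈ Set.Icc 0 Real.pi) : 0 < 1 + Real.sin θ := by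
  linarith [Real.sin_nonneg_of_mem_Icc hθ]

theorem continuousOn_mul_cos_div_one_add_sin :
    ContinuousOn (fun θ => θ * (Real.cos θ / (1 + Real.sin θ))) (Set.Icc 0 Real.pi) :=
  continuousOn_id.mul (ContinuousOn.div (by fun_prop) (by fun_prop) fun _ hθ =>
    (one_add_sin_pos hθ).ne')

/-- Folding at `π/2` gives `(2θ - π) cos θ / (1 + sin θ)`, and `θ = π/2 - 2u` turns this into `-4u
sin 2u / (1 + cos 2u) = -4u tan u`. -/
theorem integral_mul_cos_div_one_add_sin :
    ∫ θ in (0 : ℝ)..Real.pi, θ * (Real.cos θ / (1 + Real.sin θ)) =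
      Real.pi * Real.log 2 - 4 * catalanConstant := by
  have hpi := Real.pi_pos
  set h : ℝ → ℝ := fun θ => θ * (Real.cos θ / (1 + Real.sin θ)) with hh
  have hint : ∀ a b, 0 ≤ a → a ≤ b → b ≤ Real.pi → IntervalIntegrable h volume a b :=
    fun a b ha hab hb => (continuousOn_mul_cos_div_one_add_sin.mono
      (Set.Icc_subset_Icc ha hb)).intervalIntegrable_of_Icc hab
  have hfold : ∫ θ in (Real.pi / 2)..Real.pi, h θ = ∫ θ in (0 : ℝ)..(Real.pi / 2), h (Real.pi - θ) := by
    rw [intervalIntegral.integral_comp_sub_left h]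
    congr 1 <;> ring
  have hint' : IntervalIntegrable (fun θ => h (Real.pi - θ)) volume 0 (Real.pi / 2) := by
    have := (hint (Real.pi / 2) Real.pi (by positivity) (by linarith) le_rfl).symm.comp_sub_left Real.pi
    rwa [sub_self, show Real.pi - Real.pi / 2 = Real.pi / 2 by ring] at this
  rw [← intervalIntegral.integral_add_adjacent_intervals
    (hint 0 (Real.pi / 2) le_rfl (by positivity) (by linarith))
    (hint (Real.pi / 2) Real.pi (by positivity) (by linarith) le_rfl), hfold,
    ← intervalIntegral.integral_add (hint 0 (Real.pi / 2) le_rfl (by positivity) (by linarith)) hint']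
  set k : ℝ → ℝ := fun θ => h θ + h (Real.pi - θ) with hk
  have hsub : ∫ u in (0 : ℝ)..(Real.pi / 4), k (Real.pi / 2 - 2 * u) =
      2⁻¹ * ∫ θ in (0 : ℝ)..(Real.pi / 2), k θ := by
    rw [intervalIntegral.integral_comp_sub_mul k two_ne_zero, smul_eq_mul]
    congr 2 <;> ring
  have hval : ∫ u in (0 : ℝ)..(Real.pi / 4), k (Real.pi / 2 - 2 * u) =
      ∫ u in (0 : ℝ)..(Real.pi / 4), -4 * (u * Real.tan u) := by
    refine intervalIntegral.integral_congr fun u hu => ?_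
    rw [Set.uIcc_of_le (by positivity)] at hu
    have hc := (cos_pos_of_mem_Icc_pi_div_four hu).ne'
    have h1 : 1 + (2 * Real.cos u ^ 2 - 1) ≠ 0 := by
      have : 0 < Real.cos u ^ 2 := by positivity
      linarith
    simp only [hk, hh, Real.cos_pi_sub, Real.sin_pi_sub, Real.cos_pi_div_two_sub,
      Real.sin_pi_div_two_sub, Real.sin_two_mul, Real.cos_two_mul, Real.tan_eq_sin_div_cos]
    field_simp
    ring
  rw [intervalIntegral.integral_const_mul, integral_mul_tan, hsub] at hval
  linarith

/-- The pole of the tangent cancels: `tan θ (sin θ - 1) = cos θ / (1 + sin θ) - cos θ`. -/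
theorem mul_tan_mul_eq {θ : ℝ} (hθ : θ ∈ Set.Icc 0 Real.pi) (hcos : Real.cos θ ≠ 0) :
    θ * Real.tan θ * (Real.cos θ + Real.sin θ - 1) =
      θ * Real.sin θ - θ * Real.cos θ + θ * (Real.cos θ / (1 + Real.sin θ)) := by
  have h1 := (one_add_sin_pos hθ).ne'
  have h2 : Real.sin θ ^ 2 = 1 - Real.cos θ ^ 2 := Real.sin_sq θ
  rw [Real.tan_eq_sin_div_cos]
  field_simp
  have h3 : Real.sin θ ^ 3 = Real.sin θ * (1 - Real.cos θ ^ 2) := by rw [← h2]; ring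
  ring_nf
  rw [h3, h2]
  ring

/-- Only almost everywhere: at `π/2` the default `tan (π/2) = 0` makes the left side `0` and the
right side `π/2`. -/
theorem ae_mul_tan_mul_eq : ∀ᵐ θ : ℝ, θ ∈ Set.uIoc 0 Real.pi →
    θ * Real.tan θ * (Real.cos θ + Real.sin θ - 1) =
      θ * Real.sin θ - θ * Real.cos θ + θ * (Real.cos θ / (1 + Real.sin θ)) := by
  filter_upwards [Measure.ae_ne volume (Real.pi / 2)] with θ hne hmem
  rw [Set.uIoc_of_le Real.pi_pos.le] at hmem
  refine mul_tan_mul_eq ⟨hmem.1.le, hmem.2⟩ fun h => hne ?_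
  refine Real.injOn_cos ⟨hmem.1.le, hmem.2⟩ ⟨by positivity, by linarith [Real.pi_pos]⟩ ?_
  rw [h, Real.cos_pi_div_two]

theorem intervalIntegrable_mul_cos_div_one_add_sin :
    IntervalIntegrable (fun θ => θ * (Real.cos θ / (1 + Real.sin θ))) volume 0 Real.pi :=
  continuousOn_mul_cos_div_one_add_sin.intervalIntegrable_of_Icc Real.pi_pos.le

theorem intervalIntegrable_mul_tan_mul :
    IntervalIntegrable (fun θ : ℝ => θ * Real.tan θ * (Real.cos θ + Real.sin θ - 1))
      volume 0 Real.pi := by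
  have h : IntervalIntegrable (fun θ => θ * Real.sin θ - θ * Real.cos θ +
      θ * (Real.cos θ / (1 + Real.sin θ))) volume 0 Real.pi :=
    (Continuous.intervalIntegrable (by fun_prop) _ _).add
      intervalIntegrable_mul_cos_div_one_add_sin
  refine h.congr_ae ?_
  rw [Filter.EventuallyEq, ae_restrict_iff' measurableSet_uIoc]
  exact ae_mul_tan_mul_eq.mono fun θ hθ hmem => (hθ hmem).symm

theorem integral_mul_tan_mul :
    ∫ θ in (0 : ℝ)..Real.pi, θ * Real.tan θ * (Real.cos θ + Real.sin θ - 1) =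
      2 + (1 + Real.log 2) * Real.pi - 4 * catalanConstant := by
  rw [intervalIntegral.integral_congr_ae ae_mul_tan_mul_eq,
    intervalIntegral.integral_add (Continuous.intervalIntegrable (by fun_prop) _ _)
      intervalIntegrable_mul_cos_div_one_add_sin, integral_mul_cos_div_one_add_sin]
  have : ∫ θ in (0 : ℝ)..Real.pi, (θ * Real.sin θ - θ * Real.cos θ) = Real.pi + 2 := by
    rw [intervalIntegral.integral_eq_sub_of_hasDerivAt
      (f := fun θ => Real.sin θ - θ * Real.cos θ - (θ * Real.sin θ + Real.cos θ))]
    · simp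
      ring
    · intro θ _
      refine (((Real.hasDerivAt_sin θ).sub ((hasDerivAt_id θ).mul (Real.hasDerivAt_cos θ))).sub
        (((hasDerivAt_id θ).mul (Real.hasDerivAt_sin θ)).add (Real.hasDerivAt_cos θ))).congr_deriv ?_
      simp only [id]
      ring
    · exact Continuous.intervalIntegrable (by fun_prop) _ _
  rw [this]
  ring

/-! ### Numerical bounds -/

/-- A correction of a sequence of even partial sums of an alternating series converges to the sum if
the correction tends to zero. -/
theorem tendsto_catalan_partialSum_add {g : ℕ → ℝ} (hg : Filter.Tendsto g Filter.atTop (nhds 0)) :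
    Filter.Tendsto (fun m : ℕ => ∑ k ∈ Finset.range (2 * m),
      (-1 : ℝ) ^ k / (2 * (k : ℝ) + 1) ^ 2 + g m) Filter.atTop (nhds catalanConstant) := by
  have h := hasSum_catalanConstant.tendsto_sum_nat.comp
    (Filter.tendsto_id.const_mul_atTop' (two_pos : 0 < 2))
  simpa using h.add hg

theorem catalan_partialSum_succ (m : ℕ) :
    ∑ k ∈ Finset.range (2 * (m + 1)), (-1 : ℝ) ^ k / (2 * (k : ℝ) + 1) ^ 2 =
      ∑ k ∈ Finset.range (2 * m), (-1 : ℝ) ^ k / (2 * (k : ℝ) + 1) ^ 2 +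
        (1 / (4 * (m : ℝ) + 1) ^ 2 - 1 / (4 * (m : ℝ) + 3) ^ 2) := by
  have h : (-1 : ℝ) ^ (2 * m) = 1 := by simp
  rw [show 2 * (m + 1) = 2 * m + 1 + 1 by ring, Finset.sum_range_succ, Finset.sum_range_succ,
    pow_succ (-1 : ℝ) (2 * m), h]
  push_cast
  rw [show 2 * (2 * (m : ℝ)) + 1 = 4 * m + 1 by ring,
    show 2 * (2 * (m : ℝ) + 1) + 1 = 4 * m + 3 by ring]
  ring

theorem tendsto_one_div_pow_four_mul {n : ℕ} (hn : n ≠ 0) :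
    Filter.Tendsto (fun m : ℕ => 1 / (4 * (m : ℝ)) ^ n) Filter.atTop (nhds 0) := by
  simp only [one_div]
  exact ((Filter.tendsto_pow_atTop hn).comp
    (tendsto_natCast_atTop_atTop.const_mul_atTop (by norm_num : (0 : ℝ) < 4))).inv_tendsto_atTop

/-- Boole summation: the tail after `2m` terms is asymptotically `½ (y⁻² - 3y⁻⁴ + 25y⁻⁶ - ⋯)` with
`y = 4m`. Truncating after the second term makes the corrected partial sums increase to `G`;
truncating after the third, as in `catalanConstant_lt`, makes them decrease. -/
theorem catalanConstant_gt : 0.91596559 ≤ catalanConstant := by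
  set u : ℕ → ℝ := fun m => ∑ k ∈ Finset.range (2 * m), (-1 : ℝ) ^ k / (2 * (k : ℝ) + 1) ^ 2 +
    1 / 2 * (1 / (4 * (m : ℝ)) ^ 2 - 3 * (1 / (4 * (m : ℝ)) ^ 4)) with hu
  have hlim : Filter.Tendsto u Filter.atTop (nhds catalanConstant) := by
    refine tendsto_catalan_partialSum_add ?_
    simpa using ((tendsto_one_div_pow_four_mul two_ne_zero).sub
      ((tendsto_one_div_pow_four_mul four_ne_zero).const_mul 3)).const_mul 2⁻¹
  have hstep : ∀ m : ℕ, u (m + 10) ≤ u (m + 1 + 10) := by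
    intro m
    simp only [hu]
    rw [show m + 1 + 10 = m + 10 + 1 by ring, catalan_partialSum_succ (m + 10)]
    push_cast
    -- The midpoint of `4m` and `4(m + 1)` at the shifted index; it makes the difference of
    -- consecutive terms symmetric, and the numerator in `key` gets positive coefficients.
    set x : ℝ := 4 * ((m : ℝ) + 10) + 2 with hx
    have hx2 : 0 < x - 2 := by rw [hx]; ring_nf; positivity
    have hx2' : 0 < x + 2 := by linarith
    have hx1 : 0 < x - 1 := by linarith
    have hx1' : 0 < x + 1 := by linarith
    have e1 : 4 * ((m : ℝ) + 10) = x - 2 := by rw [hx]; ring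
    have e2 : 4 * ((m : ℝ) + 10 + 1) = x + 2 := by rw [hx]; ring
    rw [e1, e2, show x - 2 + 1 = x - 1 by ring, show x - 2 + 3 = x + 1 by ring]
    have key : (1 / (x - 1) ^ 2 - 1 / (x + 1) ^ 2) +
        1 / 2 * (1 / (x + 2) ^ 2 - 3 * (1 / (x + 2) ^ 4)) -
        1 / 2 * (1 / (x - 2) ^ 2 - 3 * (1 / (x - 2) ^ 4)) =
        x * (300 * ((x - 2) * (x + 2)) ^ 2 + 1368 * ((x - 2) * (x + 2)) + 1728) /
          (((x - 2) * (x + 2)) ^ 4 * ((x - 1) * (x + 1)) ^ 2) := by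
      field_simp
      ring
    have : 0 ≤ x * (300 * ((x - 2) * (x + 2)) ^ 2 + 1368 * ((x - 2) * (x + 2)) + 1728) /
          (((x - 2) * (x + 2)) ^ 4 * ((x - 1) * (x + 1)) ^ 2) := by
      have : 0 < x := by linarith
      positivity
    linarith
  have hmono : Monotone fun m => u (m + 10) := monotone_nat_of_le_succ hstep
  -- The shift by 10 makes the value at index `0` the corrected sum of twenty terms.
  have h10 := hmono.ge_of_tendsto (hlim.comp (Filter.tendsto_add_atTop_nat 10)) 0
  refine le_trans ?_ h10
  simp only [hu]
  norm_num [Finset.sum_range_succ]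

theorem catalanConstant_lt : catalanConstant ≤ 0.9159656 := by
  set u : ℕ → ℝ := fun m => ∑ k ∈ Finset.range (2 * m), (-1 : ℝ) ^ k / (2 * (k : ℝ) + 1) ^ 2 +
    1 / 2 * (1 / (4 * (m : ℝ)) ^ 2 - 3 * (1 / (4 * (m : ℝ)) ^ 4) +
      25 * (1 / (4 * (m : ℝ)) ^ 6)) with hu
  have hlim : Filter.Tendsto u Filter.atTop (nhds catalanConstant) := by
    refine tendsto_catalan_partialSum_add ?_
    simpa using (((tendsto_one_div_pow_four_mul two_ne_zero).sub
      ((tendsto_one_div_pow_four_mul four_ne_zero).const_mul 3)).add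
      ((tendsto_one_div_pow_four_mul (n := 6) (by norm_num)).const_mul 25)).const_mul 2⁻¹
  have hstep : ∀ m : ℕ, u (m + 1 + 10) ≤ u (m + 10) := by
    intro m
    simp only [hu]
    rw [show m + 1 + 10 = m + 10 + 1 by ring, catalan_partialSum_succ (m + 10)]
    push_cast
    set x : ℝ := 4 * ((m : ℝ) + 10) + 2 with hx
    have hx2 : 0 < x - 2 := by rw [hx]; ring_nf; positivity
    have hx2' : 0 < x + 2 := by linarith
    have hx1 : 0 < x - 1 := by linarith
    have hx1' : 0 < x + 1 := by linarith
    have e1 : 4 * ((m : ℝ) + 10) = x - 2 := by rw [hx]; ring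
    have e2 : 4 * ((m : ℝ) + 10 + 1) = x + 2 := by rw [hx]; ring
    rw [e1, e2, show x - 2 + 1 = x - 1 by ring, show x - 2 + 3 = x + 1 by ring]
    have key : 1 / 2 * (1 / (x - 2) ^ 2 - 3 * (1 / (x - 2) ^ 4) + 25 * (1 / (x - 2) ^ 6)) -
        1 / 2 * (1 / (x + 2) ^ 2 - 3 * (1 / (x + 2) ^ 4) + 25 * (1 / (x + 2) ^ 6)) -
        (1 / (x - 1) ^ 2 - 1 / (x + 1) ^ 2) =
        x * (6832 * ((x - 2) * (x + 2)) ^ 3 + 64972 * ((x - 2) * (x + 2)) ^ 2 +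
          211200 * ((x - 2) * (x + 2)) + 230400) /
          (((x - 2) * (x + 2)) ^ 6 * ((x - 1) * (x + 1)) ^ 2) := by
      field_simp
      ring
    have : 0 ≤ x * (6832 * ((x - 2) * (x + 2)) ^ 3 + 64972 * ((x - 2) * (x + 2)) ^ 2 +
          211200 * ((x - 2) * (x + 2)) + 230400) /
          (((x - 2) * (x + 2)) ^ 6 * ((x - 1) * (x + 1)) ^ 2) := by
      have : 0 < x := by linarith
      positivity
    linarith
  have hmono : Antitone fun m => u (m + 10) := antitone_nat_of_succ_le hstep
  have h10 := hmono.le_of_tendsto (hlim.comp (Filter.tendsto_add_atTop_nat 10)) 0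
  refine le_trans h10 ?_
  simp only [hu]
  norm_num [Finset.sum_range_succ]

theorem closedForm_bounds :
    (2.8708787 : ℝ) ≤
      Real.pi / 4 * (2 + (1 + Real.log 2) * Real.pi - 4 * catalanConstant) ∧
    Real.pi / 4 * (2 + (1 + Real.log 2) * Real.pi - 4 * catalanConstant) < (2.8708788 : ℝ) := by
  have hp1 := Real.pi_gt_d20
  have hp2 := Real.pi_lt_d20
  have hl1 := Real.log_two_gt_d9
  have hl2 := Real.log_two_lt_d9
  have hg1 := catalanConstant_gt
  have hg2 := catalanConstant_lt
  constructor
  · have h1 : (1 + 0.6931471803) * 3.14159265358979 ≤ (1 + Real.log 2) * Real.pi :=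
      mul_le_mul (by linarith) (by linarith) (by norm_num) (by linarith)
    have h2 : (3.14159265358979 : ℝ) / 4 *
        (2 + (1 + 0.6931471803) * 3.14159265358979 - 4 * 0.9159656) ≤
        Real.pi / 4 * (2 + (1 + Real.log 2) * Real.pi - 4 * catalanConstant) :=
      mul_le_mul (by linarith) (by linarith) (by norm_num) (by positivity)
    refine le_trans ?_ h2
    norm_num
  · have h1 : (1 + Real.log 2) * Real.pi ≤ (1 + 0.6931471808) * 3.14159265358980 :=
      mul_le_mul (by linarith) (by linarith) (by positivity) (by norm_num)
    have h2 : Real.pi / 4 * (2 + (1 + Real.log 2) * Real.pi - 4 * catalanConstant) ≤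
        (3.14159265358980 : ℝ) / 4 *
        (2 + (1 + 0.6931471808) * 3.14159265358980 - 4 * 0.91596559) := by
      refine mul_le_mul (by linarith) (by linarith) ?_ (by norm_num)
      have : (1 + 0.6931471803) * 3.14159265358979 ≤ (1 + Real.log 2) * Real.pi :=
        mul_le_mul (by linarith) (by linarith) (by norm_num) (by linarith)
      linarith
    refine lt_of_le_of_lt h2 ?_
    norm_num

theorem mainTheorem1 {Ω : Type*} [MeasurableSpace Ω] (P : Measure Ω) [IsProbabilityMeasure P]
    (A B C : Ω → UnitSphere)
    (hA : Measurable A) (hB : Measurable B) (hC : Measurable C)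
    (hind : iIndepFun ![A, B, C] P)
    (hAu : P.map A = uniformSphere) (hBu : P.map B = uniformSphere)
    (hCu : P.map C = uniformSphere) :
    HasCondExpAt P
      (fun ω => sphericalAngle (A ω) (B ω) (C ω) * sphericalSide (B ω) (C ω))
      (fun ω => sphericalAngle (B ω) (C ω) (A ω))
      (Real.pi / 2)
      (Real.pi / 4 *
        ∫ θ in (0 : ℝ)..Real.pi, θ * Real.tan θ * (Real.cos θ + Real.sin θ - 1)) ∧
    IntervalIntegrable (fun θ : ℝ => θ * Real.tan θ * (Real.cos θ + Real.sin θ - 1))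
      volume 0 Real.pi ∧
    Real.pi / 4 *
        (∫ θ in (0 : ℝ)..Real.pi, θ * Real.tan θ * (Real.cos θ + Real.sin θ - 1)) =
      Real.pi / 4 * (2 + (1 + Real.log 2) * Real.pi - 4 * catalanConstant) ∧
    (2.8708787 : ℝ) ≤
      Real.pi / 4 * (2 + (1 + Real.log 2) * Real.pi - 4 * catalanConstant) ∧
    Real.pi / 4 * (2 + (1 + Real.log 2) * Real.pi - 4 * catalanConstant) < (2.8708788 : ℝ) := by
  refine ⟨?_, intervalIntegrable_mul_tan_mul, by rw [integral_mul_tan_mul], closedForm_bounds⟩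
  rw [← integral_oppositeAngle_mul_side]
  exact hasCondExpAt_pi_div_two hA hB hC hind hAu hBu hCu
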